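/- Let $\Pi=(\mathsf{Gen},\mathsf{Enc},\mathsf{Dec})$ be a public key encryption scheme with plaintext space $\{0,1\}^*$ whose algorithms run in probabilistic polynomial time (PPT), which is perfectly correct ($\mathsf{Dec}_{sk}(\mathsf{Enc}_{pk}(a))=a$ for all key pairs $(pk,sk)$ output by $\mathsf{Gen}$ and all $a$), and which is IND-CPA secure against PPT adversaries. Fix $m$ groups of users; group $i$ consists of the users $u_{i,1},\dots,u_{i,n_i}$ and comes with a randomization mechanism $\mathcal R_i$; there is one server $S$. Inputs, sanitized inputs and individual results in group $i$ are bit strings of fixed lengths. Below, $\lambda$ is the security parameter, and all of the data above except $\Pi$ are independent of $\lambda$. **Protocol.** $S$ generates $(pk_c,sk_c)\leftarrow\mathsf{Gen}(1^\lambda)$ and publishes $pk_c$. User $u_{i,j}$ with input $x_{i,j}$ generates a one-time pair $(pk_{i,j},sk_{i,j})\leftarrow\mathsf{Gen}(1^\lambda)$, samples $x'_{i,j}\leftarrow\mathcal R_i(x_{i,j})$, and hands $x''_{i,j}\leftarrow\mathsf{Enc}_{pk_c}(pk_{i,j}\|x'_{i,j})$ to the functionality $\mathcal F_{\mathsf{Shuffle}}$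 of its group. For each group, $\mathcal F_{\mathsf{Shuffle}}$ independently samples a uniform permutation $\pi_i$ of $[n_i]$ and sends the list $(x''_{i,\pi_i(j)})_{j\in[n_i]}$ to $S$; if $S$ is corrupted, it also sends the adversary the leakage $\mathcal L(\pi_i)=\{(j,\pi_i^{-1}(j)) : u_{i,j}\text{ corrupted}\}$, that is, the positions of the corrupted users' messages in the shuffled list. $S$ decrypts, obtains the public keys $pk_{i,\pi_i(j)}$ and the lists $L=\big((x'_{i,\pi_i(j)})_{j\in[n_i]}\big)_{i\in[m]}$, computes $\big((y_{i,\pi_i(j)})_{j\in[n_i]}\big)_{i\in[m]}=f(L)$ for a deterministic function $f$ of its choice, and publishes for each group the list $\big(pk_{i,\pi_i(j)},\mathsf{Enc}_{pk_{i,\pi_i(j)}}(y_{i,\pi_i(j)})\big)_{j\in[n_i]}$. Every user looks up the (first) entry of the list of its group that carries its own public key and decrypts the payload; this is the user's output. The output of $S$ is $(L,f(L))$. **Ideal functionality $\mathcal F_{\mathsf{PIC}}$.** On inputs $x_{i,j}$ of the users and $f$ of the server, it samples $x'_{i,j}\leftarrow\mathcal R_i(x_{i,j})$ and independent uniform permutations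 $\pi_i$ of $[n_i]$, forms $L=\big((x'_{i,\pi_i(j)})_j\big)_i$ and $\big((y_{i,\pi_i(j)})_j\big)_i=f(L)$, and sends $y_{i,j}$ to $u_{i,j}$ and $(L,f(L))$ to $S$. The ideal-world adversary moreover gets $x'_{i,j}$ for each corrupted user $u_{i,j}$, and $\mathcal L(\pi_i)$ for all $i$. **View.** For a set $\mathcal C$ of corrupted parties (users and possibly $S$), the view of the semi-honest adversary consists of $pk_c$ and the published lists; for each corrupted user, of its input $x_{i,j}$, its sanitized input $x'_{i,j}$ and its random tapes for $\mathsf{Gen}$ and $\mathsf{Enc}$; and, if $S\in\mathcal C$, of the random tapes of $S$, the lists received from $\mathcal F_{\mathsf{Shuffle}}$ and the leakage $\mathcal L(\pi_i)$ for all $i$. **Theorem (Security).** The protocol securely computes $\mathcal F_{\mathsf{PIC}}$ in the $\mathcal F_{\mathsf{Shuffle}}$-hybrid model in the presence of PPT semi-honest adversaries with static corruption: for every set $\mathcal C$ of corrupted parties there is a PPT simulator $\mathsf{Sim}$ such that for every $f$ and every PPT distinguisher $D$ there is a negligible function $\mu$ such that for all $\lambda$ and all inputs $x=(x_{i,j})$,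 the acceptance probabilities of $D$, run on $1^\lambda$ and one of the following two random variables, differ by at most $\mu(\lambda)$: 1. (real) the view of $\mathcal C$ in an execution of the protocol, together with the outputs of all parties; 2. (ideal) the output of $\mathsf{Sim}$, together with the outputs of all parties as sent by $\mathcal F_{\mathsf{PIC}}$. Here $\mathsf{Sim}$ receives $1^\lambda$, $x_{i,j}$, $x'_{i,j}$ and $y_{i,j}$ for each corrupted user, the leakage $\mathcal L(\pi_i)$ for all $i$, and, if $S\in\mathcal C$, also $(L,f(L))$. -/

import Mathlib

noncomputable section

namespace PIC

/-! ## A probabilistic machine model with a step count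

Machines are programs over binary trees (S-expressions), with coin flips and counted loops.
Every value that is written is charged its full size.  A program whose step count is bounded by a
polynomial in the size of its input can be simulated by a probabilistic Turing machine in
polynomial time, and conversely a polynomial-time Turing machine is simulated by computing its
clock in unary and looping its transition function. -/

/-- Values of the machine: finite binary trees. -/
inductive Data : Type
  | nil : Data
  | cons (a b : Data) : Data

namespace Data

/-- The number of nodes of a tree. -/
def size : Data → ℕ
  | nil => 1
  | cons a b => a.size + b.size + 1

/-- The length of a tree read as a list. -/
def len : Data → ℕ
  | nil => 0
  | cons _ b => b.len + 1

def fst : Data → Data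
  | nil => nil
  | cons a _ => a

def snd : Data → Data
  | nil => nil
  | cons _ b => b

/-- A tree read as a bit: `nil` is `false`, everything else is `true`. -/
def toBit : Data → Bool
  | nil => false
  | cons _ _ => true

def ofBit : Bool → Data
  | false => nil
  | true => cons nil nil

def ofList : List Data → Data
  | [] => nil
  | a :: l => cons a (ofList l)

/-- The code of a bit string. -/
def ofStr (s : List Bool) : Data := ofList (s.map ofBit)

/-- A tree read as a bit string; a left inverse of `ofStr`. -/
def toStr : Data → List Bool
  | nil => []
  | cons a b => a.toBit :: b.toStr

theorem toStr_ofStr (s : List Bool) : (ofStr s).toStr = s := by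
  induction s with
  | nil => rfl
  | cons b s ih =>
    have h : (ofStr (b :: s)).toStr = (ofBit b).toBit :: (ofStr s).toStr := rfl
    rw [h, ih]
    cases b <;> rfl

/-- The unary code `1^k` of a natural number. -/
def unary (k : ℕ) : Data := ofStr (List.replicate k true)

def ofOption {α : Type} (c : α → Data) : Option α → Data
  | none => nil
  | some a => cons (c a) nil

end Data

open Data

/-- Programs.  Each of them maps an input tree to a (random) output tree. -/
inductive Prog : Type
  /-- output the constant `d` -/
  | const (d : Data) : Prog
  /-- output the input -/
  | id : Prog
  | fst : Prog
  | snd : Prog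
  /-- output a uniformly random bit -/
  | flip : Prog
  /-- run both programs on the input and pair their outputs -/
  | pair (p q : Prog) : Prog
  /-- run `p` on the input, then `q` on the output of `p` -/
  | seq (p q : Prog) : Prog
  /-- run `c` on the input; then run `p` on the input if the result is not `nil`, else `q` -/
  | cond (c p q : Prog) : Prog
  /-- run `c` on the input, let `k` be the length of the result as a list, and apply `p`
  successively `k` times, starting from the input -/
  | loop (c p : Prog) : Prog

/-- `k` successive runs of `g`, with the step counts added up. -/
def iter (g : Data → PMF (Data × ℕ)) : ℕ → Data → PMF (Data × ℕ)
  | 0, x => PMF.pure (x, 0)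
  | k + 1, x => (g x).bind fun o => (iter g k o.1).map fun o' => (o'.1, o.2 + o'.2 + 1)

/-- The joint law of the output of a program and of the number of steps of the run. -/
def run : Prog → Data → PMF (Data × ℕ)
  | .const d, _ => PMF.pure (d, d.size + 1)
  | .id, x => PMF.pure (x, 1)
  | .fst, x => PMF.pure (x.fst, 1)
  | .snd, x => PMF.pure (x.snd, 1)
  | .flip, _ => (PMF.uniformOfFintype Bool).map fun b => (ofBit b, (ofBit b).size + 1)
  | .pair p q, x => (run p x).bind fun o => (run q x).map fun o' =>
      (cons o.1 o'.1, o.2 + o'.2 + (cons o.1 o'.1).size + 1)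
  | .seq p q, x => (run p x).bind fun o => (run q o.1).map fun o' => (o'.1, o.2 + o'.2 + 1)
  | .cond c p q, x => (run c x).bind fun o =>
      (if o.1.toBit then run p x else run q x).map fun o' => (o'.1, o.2 + o'.2 + 1)
  | .loop c p, x => (run c x).bind fun o =>
      (iter (run p) o.1.len x).map fun o' => (o'.1, o.2 + o'.2 + 1)

/-- The output law of a program. -/
def output (p : Prog) (x : Data) : PMF Data := (run p x).map Prod.fst

/-- Probabilistic polynomial time: on every input and for every outcome of the coin flips, the
number of steps is at most a fixed polynomial in the size of the input. -/
def PPT (p : Prog) : Prop :=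
  ∃ q : Polynomial ℕ, ∀ x : Data, ∀ o ∈ (run p x).support, o.2 ≤ q.eval x.size

/-- `p` outputs `y` on input `x` with probability one. -/
def Computes (p : Prog) (x y : Data) : Prop := output p x = PMF.pure y

/-- Negligible functions of the security parameter. -/
def Negligible (μ : ℕ → ℝ) : Prop :=
  Asymptotics.SuperpolynomialDecay Filter.atTop (fun κ : ℕ => (κ : ℝ)) μ

/-! ## Bit vectors, coins, independent sampling -/

abbrev Bits (k : ℕ) : Type := Fin k → Bool

/-- A bit vector as a bit string. -/
def str {k : ℕ} (v : Bits k) : List Bool := List.ofFn v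

/-- The last `k` bits of a bit string. -/
def lastBits (k : ℕ) (s : List Bool) : Bits k := fun t => s.getD (s.length - k + t) false

/-- What precedes the last `k` bits of a bit string. -/
def initBits (k : ℕ) (s : List Bool) : List Bool := s.take (s.length - k)

/-- Uniformly random bit strings of length `k`. -/
def coins (k : ℕ) : PMF (Bits k) := PMF.uniformOfFintype (Bits k)

/-- Independent samples from finitely many laws. -/
def indep {ι : Type} [Fintype ι] [DecidableEq ι] {α : ι → Type} [∀ i, Fintype (α i)]
    (p : ∀ i, PMF (α i)) : PMF (∀ i, α i) :=
  PMF.ofFintype (fun g => ∏ i, p i (g i)) (by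
    rw [← Fintype.prod_sum (fun i a => p i a)]
    refine Finset.prod_eq_one fun i _ => ?_
    rw [← tsum_fintype (L := .unconditional _)]
    exact (p i).tsum_coe)

/-! ## Public key encryption -/

/-- A public key encryption scheme with plaintext space `{0,1}*`.  The randomized algorithms `gen`
and `enc` are given as deterministic functions of their input and of a uniformly random tape, the
length of which is a polynomial in the security parameter, resp. in the length of key and message.
All three algorithms run in polynomial time, and decryption is correct. -/
structure PKE where
  genLen : Polynomial ℕ
  encLen : Polynomial ℕ
  /-- `gen κ r = (pk, sk)` -/
  gen : ℕ → List Bool → List Bool × List Bool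
  /-- `enc pk m r` -/
  enc : List Bool → List Bool → List Bool → List Bool
  /-- `dec sk c`, where `none` denotes failure -/
  dec : List Bool → List Bool → Option (List Bool)
  gen_poly : ∃ p : Prog, PPT p ∧ ∀ κ r,
    Computes p (cons (unary κ) (ofStr r)) (cons (ofStr (gen κ r).1) (ofStr (gen κ r).2))
  enc_poly : ∃ p : Prog, PPT p ∧ ∀ pk m r,
    Computes p (cons (ofStr pk) (cons (ofStr m) (ofStr r))) (ofStr (enc pk m r))
  dec_poly : ∃ p : Prog, PPT p ∧ ∀ sk c,
    Computes p (cons (ofStr sk) (ofStr c)) (ofOption ofStr (dec sk c))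
  correct : ∀ (κ : ℕ) (r : Bits (genLen.eval κ)) (m : List Bool)
    (e : Bits (encLen.eval ((gen κ (str r)).1.length + m.length))),
    dec (gen κ (str r)).2 (enc (gen κ (str r)).1 m (str e)) = some m

namespace PKE

variable (E : PKE)

/-- The random tape of key generation. -/
def genTape (κ : ℕ) : PMF (Bits (E.genLen.eval κ)) := coins _

/-- The random tape of the encryption of `m` under `pk`. -/
def encTape (pk m : List Bool) : PMF (Bits (E.encLen.eval (pk.length + m.length))) := coins _

/-- The IND-CPA experiment with hidden bit `b`: the adversary gets `1^κ` and `pk`, outputs two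
messages (and a state), gets the encryption of message number `b`, and outputs a bit.  Messages
of different lengths are not answered. -/
def cpaExp (A₁ A₂ : Prog) (b : Bool) (κ : ℕ) : PMF Bool := do
  let r ← E.genTape κ
  let pk := (E.gen κ (str r)).1
  let o ← output A₁ (cons (unary κ) (ofStr pk))
  let m₀ := o.fst.toStr
  let m₁ := o.snd.fst.toStr
  if m₀.length = m₁.length then
    let m := if b then m₁ else m₀
    let e ← E.encTape pk m
    let g ← output A₂ (cons o.snd.snd (ofStr (E.enc pk m (str e))))
    pure g.toBit
  else
    pure false

/-- IND-CPA security. -/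
def INDCPA : Prop :=
  ∀ A₁ A₂ : Prog, PPT A₁ → PPT A₂ →
    Negligible fun κ =>
      |(E.cpaExp A₁ A₂ true κ true).toReal - (E.cpaExp A₁ A₂ false κ true).toReal|

end PKE

/-! ## Parties and the two ideal functionalities -/

/-- The public parameters: `m` groups, the `i`-th of which has `n i` users; the bit lengths of the
private inputs, of the sanitized inputs and of the individual results in each group; and the
randomization mechanism `R i` of each group. -/
structure Setup where
  m : ℕ
  n : Fin m → ℕ
  inLen : Fin m → ℕ
  sanLen : Fin m → ℕ
  outLen : Fin m → ℕ
  R : ∀ i, Bits (inLen i) → PMF (Bits (sanLen i))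

namespace Setup

variable (S : Setup)

/-- The user `⟨i, j⟩` is the `j`-th user of group `i`.  The same type indexes the positions in the
shuffled lists, `⟨i, j⟩` being the `j`-th position in the list of group `i`. -/
abbrev User : Type := Σ i : Fin S.m, Fin (S.n i)

/-- The parties: `none` is the server. -/
abbrev Party : Type := Option S.User

abbrev Inputs : Type := ∀ u : S.User, Bits (S.inLen u.1)

/-- Lists of sanitized inputs, one list per group. -/
abbrev Sanitized : Type := ∀ u : S.User, Bits (S.sanLen u.1)

/-- Lists of individual results, one list per group. -/
abbrev Results : Type := ∀ u : S.User, Bits (S.outLen u.1)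

/-- One permutation for each group. -/
abbrev Perms : Type := ∀ i : Fin S.m, Equiv.Perm (Fin (S.n i))

variable {S}

/-- The user whose message ends up at position `v`: after shuffling, position `j` of group `i`
holds the message of user `π_i(j)`. -/
def owner (π : S.Perms) (v : S.User) : S.User := ⟨v.1, π v.1 v.2⟩

/-- The position at which the message of user `u` ends up. -/
def position (π : S.Perms) (u : S.User) : S.User := ⟨u.1, (π u.1).symm u.2⟩

/-- The leakage about the permutations: the positions of the messages of the corrupted users. -/
def leak (C : Finset S.Party) (π : S.Perms) (u : S.User) : Option (Fin (S.n u.1)) :=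
  if some u ∈ C then some (position π u).2 else none

/-- The shuffle functionality, one independent instance for each group: the first component is the
shuffled list for the server, the second one is the leakage, which the adversary receives if the
server is corrupted. -/
def FShuffle (C : Finset S.Party) (c : S.User → List Bool) :
    PMF ((S.User → List Bool) × (∀ u : S.User, Option (Fin (S.n u.1)))) :=
  (PMF.uniformOfFintype S.Perms).map fun π => (fun v => c (owner π v), leak C π)

/-- What the functionality of private individual computation hands out. -/
structure PICOut (S : Setup) where
  /-- for the server: the shuffled sanitized inputs `L` -/
  shuffled : S.Sanitized
  /-- for the server: the list of results `f(L)`, in the same order -/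
  results : S.Results
  /-- the individual result of each user -/
  result : S.Results
  /-- for the adversary: the sanitized input of each corrupted user, which is part of the internal
  state of that user in the protocol -/
  ownSan : ∀ u : S.User, Option (Bits (S.sanLen u.1))
  /-- for the adversary: the leakage about the permutations (in the protocol a corrupted user sees
  the position of its own entry on the public bulletin board) -/
  leakage : ∀ u : S.User, Option (Fin (S.n u.1))

/-- The functionality of private individual computation. -/
def FPIC (C : Finset S.Party) (f : S.Sanitized → S.Results) (x : S.Inputs) : PMF (PICOut S) := do
  let xs ← indep fun u : S.User => S.R u.1 (x u)
  let π ← PMF.uniformOfFintype S.Perms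
  let L : S.Sanitized := fun v => xs (owner π v)
  let y : S.Results := f L
  pure
    { shuffled := L
      results := y
      result := fun u => y (position π u)
      ownSan := fun u => if some u ∈ C then some (xs u) else none
      leakage := leak C π }

/-! ## Codes of families indexed by the users -/

/-- A family of trees indexed by the users, as a list of lists. -/
def code (g : S.User → Data) : Data :=
  ofList (List.ofFn fun i : Fin S.m => ofList (List.ofFn fun j : Fin (S.n i) => g ⟨i, j⟩))

/-- A family of trees restricted to the corrupted users. -/
def codeOn (C : Finset S.Party) (g : S.User → Data) : Data :=
  code fun u => if some u ∈ C then g u else nil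

/-- A datum that is available only if the server is corrupted. -/
def ifServer (C : Finset S.Party) (d : Data) : Data := if none ∈ C then d else nil

/-- The outputs of all the users and of the server. -/
def codeOutputs (o : S.User → Option (List Bool)) (L : S.Sanitized) (y : S.Results) : Data :=
  ofList [code fun u => ofOption ofStr (o u), code fun v => ofStr (str (L v)),
    code fun v => ofStr (str (y v))]

def codeLeak (l : ∀ u : S.User, Option (Fin (S.n u.1))) : Data :=
  code fun u => ofOption (fun k : Fin (S.n u.1) => unary k) (l u)

/-! ## The protocol and the ideal world -/

/-- The last step of the protocol for user `u`, who holds the key pair `key`: look up the first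
entry in the list of the own group that carries the own public key, and decrypt its payload. -/
def retrieve (E : PKE) (key : List Bool × List Bool) (board : S.User → List Bool × List Bool)
    (u : S.User) : Option (List Bool) :=
  ((List.finRange (S.n u.1)).find? fun j => decide ((board ⟨u.1, j⟩).1 = key.1)).bind
    fun j => E.dec key.2 (board ⟨u.1, j⟩).2

/-- An execution of the protocol with semi-honest corruption of the parties in `C`: the joint law
of the view of the adversary and of the outputs of all parties.

The view consists of what is public (the public key of the server and the bulletin board), of the
inputs, sanitized inputs and random tapes of the corrupted users, and, if the server is corrupted,
of its random tapes, the list that it receives from the shuffle functionality, and the leakage. -/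
def realExec (E : PKE) (C : Finset S.Party) (f : S.Sanitized → S.Results) (x : S.Inputs)
    (κ : ℕ) : PMF Data := do
  -- the server generates its key pair and publishes the public key
  let rc ← E.genTape κ
  let pkc := (E.gen κ (str rc)).1
  let skc := (E.gen κ (str rc)).2
  -- each user generates a one-time key pair, sanitizes its input, appends it to its public key,
  -- and encrypts the result for the server
  let r ← indep fun _ : S.User => E.genTape κ
  let key : S.User → List Bool × List Bool := fun u => E.gen κ (str (r u))
  let xs ← indep fun u : S.User => S.R u.1 (x u)
  let msg : S.User → List Bool := fun u => (key u).1 ++ str (xs u)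
  let e ← indep fun u : S.User => E.encTape pkc (msg u)
  -- the ciphertexts of each group are shuffled
  let sh ← FShuffle C fun u => E.enc pkc (msg u) (str (e u))
  -- the server decrypts, evaluates `f`, and publishes the encrypted results
  let plain : S.User → List Bool := fun v => (E.dec skc (sh.1 v)).getD []
  let pkAt : S.User → List Bool := fun v => initBits (S.sanLen v.1) (plain v)
  let L : S.Sanitized := fun v => lastBits (S.sanLen v.1) (plain v)
  let y : S.Results := f L
  let es ← indep fun v : S.User => E.encTape (pkAt v) (str (y v))
  let board : S.User → List Bool × List Bool := fun v =>
    (pkAt v, E.enc (pkAt v) (str (y v)) (str (es v)))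
  let view : Data := ofList
    [ ofStr pkc,
      code fun v => cons (ofStr (board v).1) (ofStr (board v).2),
      codeOn C fun u => ofList
        [ofStr (str (x u)), ofStr (str (xs u)), ofStr (str (r u)), ofStr (str (e u))],
      ifServer C (ofList
        [ofStr (str rc), code fun v => ofStr (sh.1 v), codeLeak sh.2,
          code fun v => ofStr (str (es v))]) ]
  pure (cons view (codeOutputs (fun u => retrieve E (key u) board u) L y))

/-- What the simulator receives: the inputs, sanitized inputs and results of the corrupted users,
the leakage, and, if the server is corrupted, the output `(L, f(L))` of the server. -/
def simInput (C : Finset S.Party) (x : S.Inputs) (o : PICOut S) : Data :=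
  ofList
    [ codeOn C fun u => ofList
        [ofStr (str (x u)), ofOption (fun v => ofStr (str v)) (o.ownSan u),
          ofStr (str (o.result u))],
      codeLeak o.leakage,
      ifServer C (ofList
        [code fun v => ofStr (str (o.shuffled v)), code fun v => ofStr (str (o.results v))]) ]

/-- The ideal world with simulator `Sim`: the joint law of the simulated view and of the outputs of
all parties. -/
def idealExec (C : Finset S.Party) (f : S.Sanitized → S.Results) (x : S.Inputs)
    (Sim : Prog) (κ : ℕ) : PMF Data := do
  let o ← FPIC C f x
  let view ← output Sim (cons (unary κ) (simInput C x o))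
  pure (cons view (codeOutputs (fun u => some (str (o.result u))) o.shuffled o.results))

end Setup

/-- The probability that the distinguisher `D` accepts a sample of `X`. -/
def acceptProb (D : Prog) (κ : ℕ) (X : PMF Data) : ℝ :=
  ((X.bind fun w => (output D (cons (unary κ) w)).map toBit) true).toReal

/-- Static semi-honest security of the protocol in the shuffle-hybrid model: for every set `C` of
corrupted parties there is a probabilistic polynomial-time simulator such that no probabilistic
polynomial-time distinguisher tells the real view and outputs from the simulated view and the ideal
outputs, whatever the function `f` supplied by the server and the inputs `x` of the users. -/
def SecurelyComputesPIC (E : PKE) (S : Setup) : Prop :=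
  ∀ C : Finset S.Party, ∃ Sim : Prog, PPT Sim ∧
    ∀ (f : S.Sanitized → S.Results) (D : Prog), PPT D →
      ∃ μ : ℕ → ℝ, Negligible μ ∧ ∀ (κ : ℕ) (x : S.Inputs),
        |acceptProb D κ (Setup.realExec E C f x κ) -
          acceptProb D κ (Setup.idealExec C f x Sim κ)| ≤ μ κ

end PIC

end

noncomputable section

namespace PIC

open Data

/-! ## Size and time bounds for programs -/

/-! Inputs, sanitized inputs, permutations and results range over finite sets that do not depend on
the security parameter. It therefore suffices to fix all of them and to find a negligible bound for
each choice; finitely many such bounds add up to one that is uniform in the inputs. Since the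
results are then constants, neither a reduction nor the simulator ever evaluates `f`.

By perfect correctness the server recovers every message. Conditioned on the sanitized inputs and
the permutations (`realExec_eq`), the real world is brought to the ideal one in two moves.

The first move replaces the retrieved outputs by the ideal ones. They can differ only if two
one-time public keys coincide. This has negligible probability (`PKE.INDCPA.collision`): an attacker
who generates a key pair of its own and hits the given public key can decrypt. A union bound over
pairs of users gives `abs_retrieved_sub_le`.

The second move replaces the results that the adversary does not know by zeros. With constant
outputs the view is a function of the server's tape and of blocks, one for each position, that are
independent given that tape (`bind_fixedExec`). If neither the server nor the owner of a position is
corrupted, its block is just a public key with an encryption of the result, and nothing else depends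
on that key pair. So IND-CPA security allows the replacement, one position at a time
(`negligible_replace_one`, `exists_negligible_replace`). Secrecy under the server's own key is never
needed, because only the server receives those ciphertexts.

The resulting view depends only on what the simulator receives (`viewLaw_dummy_congr`) and is
efficiently samplable for each fixed choice of the data, so a finite table lookup is a simulator
(`exists_simulator`). The calculus of `Eff` and `Det` certifies polynomial time for the simulator
and the reductions. -/

@[simp] theorem Data.fst_cons (a b : Data) : (Data.cons a b).fst = a := rfl
@[simp] theorem Data.snd_cons (a b : Data) : (Data.cons a b).snd = b := rfl
@[simp] theorem Data.toBit_cons (a b : Data) : (Data.cons a b).toBit = true := rfl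
@[simp] theorem Data.toBit_nil : Data.nil.toBit = false := rfl
@[simp] theorem Data.toBit_ofBit (b : Bool) : (ofBit b).toBit = b := by cases b <;> rfl

theorem Data.one_le_size (d : Data) : 1 ≤ d.size := by cases d <;> simp [Data.size]

theorem Data.fst_size_le (d : Data) : d.fst.size ≤ d.size := by
  cases d <;> simp [Data.size, Data.fst]; omega

theorem Data.snd_size_le (d : Data) : d.snd.size ≤ d.size := by
  cases d <;> simp [Data.size, Data.snd]; omega

theorem Data.len_le_size (d : Data) : d.len ≤ d.size := by
  induction d with
  | nil => simp [Data.len]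
  | cons a b _ ih => simp only [Data.size, Data.len]; omega

theorem eval_mono (q : Polynomial ℕ) {a b : ℕ} (h : a ≤ b) : q.eval a ≤ q.eval b := by
  simp only [Polynomial.eval_eq_sum, Polynomial.sum]
  gcongr

theorem iter_size_le {g : Data → PMF (Data × ℕ)}
    (hg : ∀ x, ∀ o ∈ (g x).support, o.1.size ≤ x.size + o.2) (k : ℕ) :
    ∀ x, ∀ o ∈ (iter g k x).support, o.1.size ≤ x.size + o.2 := by
  induction k with
  | zero => intro x o ho; simp [iter] at ho; simp [ho]
  | succ k ih =>
    intro x o ho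
    simp only [iter, PMF.mem_support_bind_iff, PMF.support_map, Set.mem_image] at ho
    obtain ⟨a, ha, b, hb, rfl⟩ := ho
    have := hg _ _ ha
    have := ih _ _ hb
    simp only; omega

/-- The output of a run is at most as large as its input plus the number of steps. -/
theorem run_size_le (p : Prog) : ∀ x, ∀ o ∈ (run p x).support, o.1.size ≤ x.size + o.2 := by
  induction p with
  | const d => intro x o ho; simp [run] at ho; simp [ho]; omega
  | id => intro x o ho; simp [run] at ho; simp [ho]
  | fst => intro x o ho; simp [run] at ho; have := x.fst_size_le; simp [ho]; omega
  | snd => intro x o ho; simp [run] at ho; have := x.snd_size_le; simp [ho]; omega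
  | flip =>
    intro x o ho
    simp only [run, PMF.support_map, Set.mem_image] at ho
    obtain ⟨b, _, rfl⟩ := ho
    simp only; omega
  | pair p q hp hq =>
    intro x o ho
    simp only [run, PMF.mem_support_bind_iff, PMF.support_map, Set.mem_image] at ho
    obtain ⟨a, ha, b, hb, rfl⟩ := ho
    simp only; omega
  | seq p q hp hq =>
    intro x o ho
    simp only [run, PMF.mem_support_bind_iff, PMF.support_map, Set.mem_image] at ho
    obtain ⟨a, ha, b, hb, rfl⟩ := ho
    have := hp _ _ ha
    have := hq _ _ hb
    simp only; omega
  | cond c p q hc hp hq =>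
    intro x o ho
    simp only [run, PMF.mem_support_bind_iff, PMF.support_map, Set.mem_image] at ho
    obtain ⟨a, ha, b, hb, rfl⟩ := ho
    split_ifs at hb
    · have := hp _ _ hb
      simp only; omega
    · have := hq _ _ hb
      simp only; omega
  | loop c p hc hp =>
    intro x o ho
    simp only [run, PMF.mem_support_bind_iff, PMF.support_map, Set.mem_image] at ho
    obtain ⟨a, ha, b, hb, rfl⟩ := ho
    have := iter_size_le hp _ _ _ hb
    simp only; omega

theorem PPT_const (d : Data) : PPT (.const d) :=
  ⟨Polynomial.C (d.size + 1), fun x o ho => by simp [run] at ho; simp [ho]⟩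

theorem PPT_id : PPT .id := ⟨1, fun x o ho => by simp [run] at ho; simp [ho]⟩
theorem PPT_fst : PPT .fst := ⟨1, fun x o ho => by simp [run] at ho; simp [ho]⟩
theorem PPT_snd : PPT .snd := ⟨1, fun x o ho => by simp [run] at ho; simp [ho]⟩

theorem PPT_flip : PPT .flip := by
  refine ⟨Polynomial.C 4, fun x o ho => ?_⟩
  simp only [run, PMF.support_map, Set.mem_image] at ho
  obtain ⟨b, _, rfl⟩ := ho
  cases b <;> simp [ofBit, Data.size]

theorem PPT.pair {p q : Prog} (hp : PPT p) (hq : PPT q) : PPT (.pair p q) := by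
  obtain ⟨P, hP⟩ := hp
  obtain ⟨Q, hQ⟩ := hq
  -- The pair that is written is charged its full size. By `run_size_le` this is at most twice the
  -- input plus the steps of both runs, plus one; hence the factors `2`.
  refine ⟨2 * P + 2 * Q + 2 * Polynomial.X + 2, fun x o ho => ?_⟩
  simp only [run, PMF.mem_support_bind_iff, PMF.support_map, Set.mem_image] at ho
  obtain ⟨a, ha, b, hb, rfl⟩ := ho
  have h1 := hP _ _ ha
  have h2 := hQ _ _ hb
  have h3 := run_size_le _ _ _ ha
  have h4 := run_size_le _ _ _ hb
  simp [Data.size]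
  omega

theorem PPT.seq {p q : Prog} (hp : PPT p) (hq : PPT q) : PPT (.seq p q) := by
  obtain ⟨P, hP⟩ := hp
  obtain ⟨Q, hQ⟩ := hq
  -- The second program runs on an output of size at most `X + P`.
  refine ⟨P + Q.comp (Polynomial.X + P) + 1, fun x o ho => ?_⟩
  simp only [run, PMF.mem_support_bind_iff, PMF.support_map, Set.mem_image] at ho
  obtain ⟨a, ha, b, hb, rfl⟩ := ho
  have h1 := hP _ _ ha
  have h2 := hQ _ _ hb
  have h3 := run_size_le _ _ _ ha
  have h4 := eval_mono Q (h3.trans (Nat.add_le_add_left h1 _))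
  simp [Polynomial.eval_comp]
  omega

theorem PPT.cond {c p q : Prog} (hc : PPT c) (hp : PPT p) (hq : PPT q) :
    PPT (.cond c p q) := by
  obtain ⟨R, hR⟩ := hc
  obtain ⟨P, hP⟩ := hp
  obtain ⟨Q, hQ⟩ := hq
  refine ⟨P + Q + R + 1, fun x o ho => ?_⟩
  simp only [run, PMF.mem_support_bind_iff, PMF.support_map, Set.mem_image] at ho
  obtain ⟨a, ha, b, hb, rfl⟩ := ho
  have h1 := hR _ _ ha
  simp only [Polynomial.eval_add, Polynomial.eval_one]
  split_ifs at hb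
  · have := hP _ _ hb
    omega
  · have := hQ _ _ hb
    omega

/-- A loop runs in polynomial time if its body does, provided that the body keeps the first
component of the state, which controls the loop, and that it enlarges the state by no more than a
polynomial in the size of that component. -/
theorem PPT.loop_fst {p : Prog} (hp : PPT p) {g : Polynomial ℕ}
    (hg : ∀ x, ∀ o ∈ (run p x).support,
      o.1.fst = x.fst ∧ o.1.size ≤ x.size + g.eval x.fst.size) :
    PPT (.loop .fst p) := by
  obtain ⟨P, hP⟩ := hp
  -- The growth per round depends only on the first component, which never changes, so growth is
  -- additive and does not compound.
  have key : ∀ k x, ∀ o ∈ (iter (run p) k x).support,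
      o.2 ≤ k * (P.eval (x.size + k * g.eval x.fst.size) + 1) := by
    intro k
    induction k with
    | zero => intro x o ho; simp [iter] at ho; simp [ho]
    | succ k ih =>
      intro x o ho
      simp only [iter, PMF.mem_support_bind_iff, PMF.support_map, Set.mem_image] at ho
      obtain ⟨a, ha, b, hb, rfl⟩ := ho
      have h1 := hP _ _ ha
      obtain ⟨h2, h3⟩ := hg _ _ ha
      have h4 := ih _ _ hb
      rw [h2] at h4
      have h5 : P.eval x.size ≤ P.eval (x.size + (k + 1) * g.eval x.fst.size) :=
        eval_mono P (Nat.le_add_right _ _)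
      have h6 : P.eval (a.1.size + k * g.eval x.fst.size) ≤
          P.eval (x.size + (k + 1) * g.eval x.fst.size) := eval_mono P (by
        rw [add_mul]; omega)
      have h7 := Nat.mul_le_mul_left k (Nat.add_le_add_right h6 1)
      simp only
      rw [add_mul k 1 (_ + 1)]
      omega
  -- The number of rounds is at most the input size; the final `2` pays for evaluating `fst` and for
  -- the loop instruction.
  refine ⟨Polynomial.X * (P.comp (Polynomial.X + Polynomial.X * g) + 1) + 2, fun x o ho => ?_⟩
  simp only [run, PMF.pure_bind, PMF.support_map, Set.mem_image] at ho
  obtain ⟨b, hb, rfl⟩ := ho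
  have h1 := key _ _ _ hb
  have hk : x.fst.len ≤ x.size := (Data.len_le_size _).trans x.fst_size_le
  have hg' : g.eval x.fst.size ≤ g.eval x.size := eval_mono g x.fst_size_le
  have h2 : x.fst.len * (P.eval (x.size + x.fst.len * g.eval x.fst.size) + 1) ≤
      x.size * (P.eval (x.size + x.size * g.eval x.size) + 1) := by
    have := eval_mono P (Nat.add_le_add_left (Nat.mul_le_mul hk hg') x.size)
    gcongr
  simp [Polynomial.eval_comp]
  omega

/-! ## Output laws -/

theorem output_const (d x : Data) : output (.const d) x = PMF.pure d := by
  simp [output, run, PMF.pure_map]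
theorem output_id (x : Data) : output .id x = PMF.pure x := by
  simp [output, run, PMF.pure_map]
theorem output_fst (x : Data) : output .fst x = PMF.pure x.fst := by
  simp [output, run, PMF.pure_map]
theorem output_snd (x : Data) : output .snd x = PMF.pure x.snd := by
  simp [output, run, PMF.pure_map]

theorem output_flip (x : Data) :
    output .flip x = (PMF.uniformOfFintype Bool).map ofBit := by
  simp only [output, run, PMF.map_comp]; rfl

theorem output_pair (p q : Prog) (x : Data) : output (.pair p q) x =
    (output p x).bind fun a => (output q x).bind fun b => PMF.pure (cons a b) := by
  simp only [output, run, PMF.map_bind, PMF.map_comp, PMF.bind_map]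
  rfl

theorem output_seq (p q : Prog) (x : Data) :
    output (.seq p q) x = (output p x).bind (output q) := by
  simp only [output, run, PMF.map_bind, PMF.map_comp, PMF.bind_map]
  rfl

theorem output_cond (c p q : Prog) (x : Data) : output (.cond c p q) x =
    (output c x).bind fun a => if a.toBit then output p x else output q x := by
  simp only [output, run, PMF.map_bind, PMF.map_comp, PMF.bind_map]
  congr 1
  funext a
  simp only [Function.comp]
  split_ifs <;> rfl

/-- Iterated sampling. -/
def kiter (G : Data → PMF Data) : ℕ → Data → PMF Data
  | 0, x => PMF.pure x
  | k + 1, x => (G x).bind (kiter G k)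

theorem map_fst_iter (p : Prog) (k : ℕ) :
    ∀ x, (iter (run p) k x).map Prod.fst = kiter (output p) k x := by
  induction k with
  | zero => intro x; simp [iter, kiter, PMF.pure_map]
  | succ k ih =>
    intro x
    simp only [iter, kiter, output, PMF.map_bind, PMF.map_comp, PMF.bind_map]
    congr 1
    funext a
    exact ih a.1

theorem output_loop_fst (p : Prog) (x : Data) :
    output (.loop .fst p) x = kiter (output p) x.fst.len x := by
  rw [← map_fst_iter]
  simp only [output, run, PMF.pure_bind, PMF.map_comp]
  rfl

/-! ## Efficiently samplable families -/

/-- The family of laws `F` can be sampled in polynomial time from the code `c γ` of the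
parameter `γ`. -/
def Eff {Γ : Type} (c : Γ → Data) (F : Γ → PMF Data) : Prop :=
  ∃ p : Prog, PPT p ∧ ∀ γ, output p (c γ) = F γ

/-- Deterministic polynomial time. -/
abbrev Det {Γ : Type} (c : Γ → Data) (t : Γ → Data) : Prop := Eff c fun γ => PMF.pure (t γ)

section Eff

variable {Γ Δ : Type} {c : Γ → Data}

theorem Eff.of_prog {p : Prog} (hp : PPT p) : Eff (fun d => d) (output p) := ⟨p, hp, fun _ => rfl⟩

theorem Det.const (d : Data) : Det c fun _ => d := ⟨.const d, PPT_const d, fun _ => output_const _ _⟩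

theorem Det.input : Det c c := ⟨.id, PPT_id, fun _ => output_id _⟩

theorem Eff.comp {e : Δ → Data} {G : Δ → PMF Data} (hG : Eff e G) (h : Γ → Δ)
    (ht : Det c fun γ => e (h γ)) : Eff c fun γ => G (h γ) := by
  obtain ⟨p, hp, hp'⟩ := hG
  obtain ⟨q, hq, hq'⟩ := ht
  exact ⟨.seq q p, hq.seq hp, fun γ => by rw [output_seq, hq', PMF.pure_bind, hp']⟩

theorem Det.comp {e : Δ → Data} {G : Δ → Data} (hG : Det e G) (h : Γ → Δ)
    (ht : Det c fun γ => e (h γ)) : Det c fun γ => G (h γ) := Eff.comp hG h ht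

theorem Det.fst {t : Γ → Data} (ht : Det c t) : Det c fun γ => (t γ).fst :=
  Eff.comp (e := fun d => d) (G := fun d => PMF.pure d.fst) ⟨.fst, PPT_fst, output_fst⟩ t ht

theorem Det.snd {t : Γ → Data} (ht : Det c t) : Det c fun γ => (t γ).snd :=
  Eff.comp (e := fun d => d) (G := fun d => PMF.pure d.snd) ⟨.snd, PPT_snd, output_snd⟩ t ht

theorem Det.cons {s t : Γ → Data} (hs : Det c s) (ht : Det c t) :
    Det c fun γ => Data.cons (s γ) (t γ) := by
  obtain ⟨p, hp, hp'⟩ := hs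
  obtain ⟨q, hq, hq'⟩ := ht
  exact ⟨.pair p q, hp.pair hq, fun γ => by simp [output_pair, hp', hq']⟩

/-- The program keeps the code of the parameter next to the sample, so later stages can use both.
Nested sampling thus leads to nested pairs of codes. -/
theorem Eff.bind {α : Type} {d : α → Data} {F : Γ → PMF α} {G : Γ → α → PMF Data}
    (hF : Eff c fun γ => (F γ).map d)
    (hG : Eff (fun a : Γ × α => Data.cons (c a.1) (d a.2)) fun a => G a.1 a.2) :
    Eff c fun γ => (F γ).bind (G γ) := by
  obtain ⟨p, hp, hp'⟩ := hF
  obtain ⟨q, hq, hq'⟩ := hG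
  refine ⟨.seq (.pair .id p) q, (PPT_id.pair hp).seq hq, fun γ => ?_⟩
  simp only [output_seq, output_pair, output_id, PMF.pure_bind, hp', PMF.bind_map, PMF.bind_bind]
  congr 1
  funext a
  exact (PMF.pure_bind _ _).trans (hq' (γ, a))

theorem Eff.cond {t : Γ → Data} {F G : Γ → PMF Data} (ht : Det c t) (hF : Eff c F)
    (hG : Eff c G) : Eff c fun γ => if (t γ).toBit then F γ else G γ := by
  obtain ⟨r, hr, hr'⟩ := ht
  obtain ⟨p, hp, hp'⟩ := hF
  obtain ⟨q, hq, hq'⟩ := hG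
  exact ⟨.cond r p q, hr.cond hp hq, fun γ => by
    rw [output_cond, hr', PMF.pure_bind, hp', hq']⟩

theorem Det.cond {t u v : Γ → Data} (ht : Det c t) (hu : Det c u) (hv : Det c v) :
    Det c fun γ => if (t γ).toBit then u γ else v γ := by
  have := Eff.cond ht hu hv
  unfold Det
  convert this using 2
  simp only
  split_ifs <;> rfl

theorem Det.ofFn {n : ℕ} {t : Fin n → Γ → Data} (ht : ∀ i, Det c (t i)) :
    Det c fun γ => ofList (List.ofFn fun i => t i γ) := by
  induction n with
  | zero => exact Det.const _
  | succ n ih =>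
    simp only [List.ofFn_succ]
    exact (ht 0).cons (ih fun i => ht i.succ)

theorem Eff.loop_fst {G : Data → PMF Data} (hG : Eff (fun d => d) G) {g : Polynomial ℕ}
    (hg : ∀ x, ∀ o ∈ (G x).support, o.fst = x.fst ∧ o.size ≤ x.size + g.eval x.fst.size) :
    Eff (fun d => d) fun d => kiter G d.fst.len d := by
  obtain ⟨p, hp, hp'⟩ := hG
  have hpG : output p = G := funext hp'
  refine ⟨.loop .fst p, hp.loop_fst fun x o ho => hg x o.1 ?_, fun d => ?_⟩
  · rw [← hpG, output, PMF.support_map]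
    exact ⟨o, ho, rfl⟩
  · rw [output_loop_fst, hpG]

theorem kiter_pure (s : Data → Data) (k : ℕ) (d : Data) :
    kiter (fun d => PMF.pure (s d)) k d = PMF.pure (s^[k] d) := by
  induction k generalizing d with
  | zero => rfl
  | succ k ih => simp [kiter, ih]

theorem Det.loop_fst {s : Data → Data} (hs : Det (fun d => d) s) (k : ℕ)
    (hk : ∀ x, (s x).fst = x.fst ∧ (s x).size ≤ x.size + k) :
    Det (fun d => d) fun d => s^[d.fst.len] d := by
  have := Eff.loop_fst hs (g := Polynomial.C k) (fun x o ho => by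
    simp at ho; subst ho; simpa using hk x)
  simpa only [kiter_pure] using this

instance instDecidableEqData : DecidableEq Data := Classical.decEq _

/-! ### Comparison with constants and table lookup -/

/-- The test is built by recursion on the constant tree, so it needs no loop; its running time may
depend on `d`, which is fixed. -/
theorem Det.eqConst (d : Data) : Det (fun x => x) fun x => ofBit (decide (x = d)) := by
  induction d with
  | nil =>
    have := Det.cond (Det.input (c := fun x : Data => x)) (Det.const (ofBit false))
      (Det.const (ofBit true))
    convert this using 3 with x
    cases x <;> simp
  | cons a b iha ihb =>
    have h1 := iha.comp (c := fun x : Data => x) Data.fst Det.input.fst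
    have h2 := ihb.comp (c := fun x : Data => x) Data.snd Det.input.snd
    have := Det.cond (Det.input (c := fun x : Data => x))
      (Det.cond h1 h2 (Det.const (ofBit false))) (Det.const (ofBit false))
    convert this using 3 with x
    cases x with
    | nil => simp [toBit]
    | cons u v =>
      by_cases hu : u = a
      · simp [hu]
      · simp [hu]

theorem Det.eq_const {t : Γ → Data} (ht : Det c t) (d : Data) :
    Det c fun γ => ofBit (decide (t γ = d)) := (Det.eqConst d).comp t ht

/-- A family with an additional parameter from a finite type can be sampled from the code of that
parameter. -/
theorem Eff.table {T : Type} [Finite T] {w : T → Data} {F : T → Γ → PMF Data}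
    (hF : ∀ t, Eff c (F t)) (hw : ∀ t t', w t = w t' → F t = F t') :
    Eff (fun a : Γ × T => Data.cons (c a.1) (w a.2)) fun a => F a.2 a.1 := by
  -- A cascade of comparisons, one for each entry of the table, each with its own hard-wired
  -- sampler.
  have key : ∀ l : List T, ∃ p, PPT p ∧ ∀ t ∈ l, ∀ γ,
      output p (Data.cons (c γ) (w t)) = F t γ := by
    intro l
    induction l with
    | nil => exact ⟨.id, PPT_id, by simp⟩
    | cons t l ih =>
      obtain ⟨p, hp, hp'⟩ := ih
      obtain ⟨q, hq, hq'⟩ := hF t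
      obtain ⟨r, hr, hr'⟩ := (Det.eqConst (w t)).comp (c := fun x : Data => x) Data.snd
        Det.input.snd
      refine ⟨.cond r (.seq .fst q) p, hr.cond (PPT_fst.seq hq) hp, fun t' ht' γ => ?_⟩
      rw [output_cond, hr', PMF.pure_bind, toBit_ofBit, output_seq, output_fst, PMF.pure_bind]
      by_cases h : w t' = w t
      -- Different parameters may share a code. The first match then answers, which is harmless by
      -- `hw`.
      · rw [if_pos (decide_eq_true (by exact h)), hw t' t h]
        exact hq' γ
      · rw [if_neg (by rw [decide_eq_true_eq]; exact h)]
        rcases List.mem_cons.1 ht' with rfl | ht'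
        · exact absurd rfl h
        · exact hp' t' ht' γ
  have := Fintype.ofFinite T
  obtain ⟨p, hp, hp'⟩ := key Finset.univ.toList
  exact ⟨p, hp, fun a => hp' _ (by simp) _⟩

/-! ### Strings -/

theorem len_ofStr (s : List Bool) : (ofStr s).len = s.length := by
  induction s with
  | nil => rfl
  | cons b s ih => exact congrArg (· + 1) ih

theorem ofStr_injective : Function.Injective ofStr :=
  Function.LeftInverse.injective toStr_ofStr

theorem ofStr_cons (b : Bool) (s : List Bool) : ofStr (b :: s) = cons (ofBit b) (ofStr s) := rfl

/-- Moves the first bit of one string to the front of another one. -/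
def revStep (d : Data) : Data :=
  cons d.fst (cons d.snd.fst.snd (cons d.snd.fst.fst d.snd.snd))

/-- Polynomial time is required on all trees, including malformed states. The constant `6` is
attained at `nil`, which becomes a tree with seven nodes. -/
theorem revStep_size (d : Data) : (revStep d).size ≤ d.size + 6 := by
  rcases d with _ | ⟨a, _ | ⟨_ | ⟨b, d⟩, e⟩⟩ <;>
    simp [revStep, Data.fst, Data.snd, Data.size] <;> omega

theorem iterate_revStep (a : Data) (s t : List Bool) :
    revStep^[s.length] (cons a (cons (ofStr s) (ofStr t))) =
      cons a (cons nil (ofStr (s.reverse ++ t))) := by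
  induction s generalizing t with
  | nil => rfl
  | cons b s ih =>
    rw [List.length_cons, Function.iterate_succ_apply]
    simpa [revStep, ofStr_cons] using ih (b :: t)

/-- The first component of the loop state is a second copy of `s` that serves only as a counter. -/
theorem Det.revAppend {s t : Γ → List Bool} (hs : Det c fun γ => ofStr (s γ))
    (ht : Det c fun γ => ofStr (t γ)) : Det c fun γ => ofStr ((s γ).reverse ++ t γ) := by
  have i := Det.input (c := fun x : Data => x)
  have h : Det (fun x : Data => x) revStep :=
    i.fst.cons (i.snd.fst.snd.cons (i.snd.fst.fst.cons i.snd.snd))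
  have := (Det.comp (Det.loop_fst h 6 fun x => ⟨rfl, revStep_size x⟩)
    (fun γ => Data.cons (ofStr (s γ)) (Data.cons (ofStr (s γ)) (ofStr (t γ))))
    (hs.cons (hs.cons ht))).snd.snd
  simpa only [Data.fst_cons, len_ofStr, iterate_revStep, Data.snd_cons] using this

/-- Reversing twice restores the order of `s`. -/
theorem Det.append {s t : Γ → List Bool} (hs : Det c fun γ => ofStr (s γ))
    (ht : Det c fun γ => ofStr (t γ)) : Det c fun γ => ofStr (s γ ++ t γ) := by
  have := Det.revAppend (t := t) (Det.revAppend (t := fun _ => []) hs (Det.const nil)) ht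
  simpa using this

/-- One step of the comparison of two strings. -/
def cmpStep (d : Data) : Data :=
  cons d.fst (cons (cons d.snd.fst.fst.snd d.snd.fst.snd.snd)
    (if d.snd.fst.snd.toBit then
      (if d.snd.fst.fst.fst.toBit then
        (if d.snd.fst.snd.fst.toBit then d.snd.snd else nil)
      else (if d.snd.fst.snd.fst.toBit then nil else d.snd.snd))
    else nil))

theorem det_cmpStep : Det (fun d => d) cmpStep := by
  have i := Det.input (c := fun x : Data => x)
  exact i.fst.cons ((i.snd.fst.fst.snd.cons i.snd.fst.snd.snd).cons
    (Det.cond i.snd.fst.snd (Det.cond i.snd.fst.fst.fst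
      (Det.cond i.snd.fst.snd.fst i.snd.snd (Det.const nil))
      (Det.cond i.snd.fst.snd.fst (Det.const nil) i.snd.snd)) (Det.const nil)))

theorem cmpStep_size (d : Data) : (cmpStep d).size ≤ d.size + 6 := by
  have h : ∀ (p q r : Bool) (e : Data), (if p then (if q then (if r then e else nil)
      else (if r then nil else e)) else nil : Data).size ≤ e.size := by
    intro p q r e
    have := e.one_le_size
    cases p <;> cases q <;> cases r <;> simp [Data.size] <;> omega
  have h1 := h d.snd.fst.snd.toBit d.snd.fst.fst.fst.toBit d.snd.fst.snd.fst.toBit d.snd.snd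
  simp only [cmpStep, Data.size]
  have h2 := d.snd.fst.fst.snd_size_le
  have h3 := d.snd.fst.snd.snd_size_le
  have h4 : ∀ e : Data, e.fst.size + e.snd.size ≤ e.size + 1 := by
    intro e; cases e <;> simp [Data.fst, Data.snd, Data.size]; omega
  have h5 := h4 d.snd.fst
  have h6 := h4 d.snd
  have h7 := h4 d
  omega

/-- The loop runs for the length of `s`. If `t` is shorter, a step finds it exhausted and clears the
flag; if `t` is longer, a nonempty rest `u` remains. Equality therefore means that the flag has
survived and nothing is left. -/
theorem iterate_cmpStep (a : Data) (s t : List Bool) (g : Bool) :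
    ∃ u : List Bool, ∃ g' : Bool,
      cmpStep^[s.length] (cons a (cons (cons (ofStr s) (ofStr t)) (ofBit g))) =
        cons a (cons (cons nil (ofStr u)) (ofBit g')) ∧
      ((g' = true ∧ u = []) ↔ (g = true ∧ s = t)) := by
  induction s generalizing t g with
  | nil => exact ⟨t, g, rfl, by simp [eq_comm]⟩
  | cons b s ih =>
    simp only [List.length_cons, Function.iterate_succ_apply]
    rcases t with _ | ⟨b', t⟩
    · obtain ⟨u, g', h, h'⟩ := ih [] false
      exact ⟨u, g', by rw [← h]; rfl, by simp [h']⟩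
    · obtain ⟨u, g', h, h'⟩ := ih t (g && (b == b'))
      refine ⟨u, g', ?_, ?_⟩
      · rw [← h]
        cases b <;> cases b' <;> cases g <;> rfl
      · rw [h']
        simp [and_assoc]

theorem Det.eqStr {s t : Γ → List Bool} (hs : Det c fun γ => ofStr (s γ))
    (ht : Det c fun γ => ofStr (t γ)) : Det c fun γ => ofBit (decide (s γ = t γ)) := by
  have h := Det.comp (Det.loop_fst det_cmpStep 6 fun x => ⟨rfl, cmpStep_size x⟩)
    (fun γ => Data.cons (ofStr (s γ)) (Data.cons (Data.cons (ofStr (s γ)) (ofStr (t γ)))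
      (ofBit true))) (hs.cons ((hs.cons ht).cons (Det.const _)))
  have h' := Det.cond h.snd.fst.snd (Det.const (ofBit false)) h.snd.snd
  convert h' using 3 with γ
  simp only [Data.fst_cons, len_ofStr]
  obtain ⟨u, g, e, hg⟩ := iterate_cmpStep (ofStr (s γ)) (s γ) (t γ) true
  rw [e]
  simp only [true_and] at hg
  have hg' : decide (s γ = t γ) = decide (g = true ∧ u = []) := decide_eq_decide.2 hg.symm
  rw [hg']
  rcases u with _ | ⟨b, u⟩
  · cases g <;> simp [ofStr, ofList]
  · simp [ofStr, ofList]

end Eff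

/-! ## Random tapes -/

/-- A uniformly random string of length `k`. -/
def tape (k : ℕ) : PMF (List Bool) := (coins k).map str

theorem tape_zero : tape 0 = PMF.pure [] := by
  have : (str : Bits 0 → List Bool) = fun _ => [] := funext fun v => by simp [str]
  rw [tape, this]
  exact PMF.map_const _ _

theorem tape_succ (k : ℕ) : tape (k + 1) =
    (PMF.uniformOfFintype Bool).bind fun b => (tape k).map (List.cons b) := by
  have h : coins (k + 1) = (PMF.uniformOfFintype Bool).bind fun b =>
      (coins k).map fun v => (Fin.cons b v : Bits (k + 1)) := by
    ext v
    obtain ⟨b, w, rfl⟩ : ∃ (b : Bool) (w : Bits k), v = Fin.cons b w :=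
      ⟨v 0, Fin.tail v, (Fin.cons_self_tail v).symm⟩
    have h1 : ∀ (b' : Bool) (w' : Bits k),
        ((Fin.cons b w : Bits (k + 1)) = Fin.cons b' w') = (b = b' ∧ w = w') := fun b' w' =>
      propext (Fin.cons_inj (α := fun _ => Bool))
    simp only [coins, PMF.bind_apply, PMF.map_apply, PMF.uniformOfFintype_apply, h1]
    rw [tsum_eq_single b (by intro b' hb'; simp [hb'.symm]),
      tsum_eq_single w (by intro w' hw'; simp [hw'.symm])]
    simp [pow_succ, ENNReal.mul_inv]
    rw [mul_comm]
  rw [tape, h, PMF.map_bind]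
  congr 1
  funext b
  rw [tape, PMF.map_comp, PMF.map_comp]
  congr 1
  funext v
  simp [str, List.ofFn_succ]

theorem tape_add (k l : ℕ) : tape (k + l) =
    (tape l).bind fun s => (tape k).map fun t => t ++ s := by
  induction k with
  | zero =>
    simp only [tape_zero, Nat.zero_add, PMF.pure_map, List.nil_append]
    exact (PMF.bind_pure _).symm
  | succ k ih =>
    rw [Nat.add_right_comm, tape_succ, ih]
    simp only [PMF.map_bind, PMF.map_comp, tape_succ]
    rw [PMF.bind_comm]
    rfl

section Tape

variable {Γ : Type} {c : Γ → Data}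

theorem map_id_fun {α : Type} (p : PMF α) : p.map (fun a => a) = p := PMF.map_id p

theorem map_pure_eq_bind {α β : Type} (f : α → β) (p : PMF α) :
    p.map f = p.bind fun a => PMF.pure (f a) := rfl

/-- Random strings of polynomial length can be sampled and prepended to a string, the length being
controlled by a datum that is kept. -/
def SamplesTape (P : ℕ → ℕ) : Prop :=
  ∃ (G : Data → PMF Data) (g : Polynomial ℕ),
    Eff (fun d => d) G ∧
    (∀ x, ∀ o ∈ (G x).support, o.fst = x.fst ∧ o.size ≤ x.size + g.eval x.fst.size) ∧
    ∀ a s, G (cons a (ofStr s)) = (tape (P a.len)).map fun t => cons a (ofStr (t ++ s))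

/-- Samplers are built along the polynomial: a sum runs two samplers in succession, a constant flips
that many coins, and multiplication by the variable loops over the kept datum `a`. Bounding the
growth in terms of `a` alone is what keeps nested loops polynomial. -/
theorem samplesTape (P : Polynomial ℕ) : SamplesTape fun n => P.eval n := by
  have i := Det.input (c := fun x : Data => x)
  have hzero : SamplesTape fun _ => 0 :=
    ⟨PMF.pure, 0, i, fun x o ho => by simp at ho; simp [ho], fun a s => by
      simp [tape_zero, PMF.pure_map]⟩
  have hadd : ∀ P Q : ℕ → ℕ, SamplesTape P → SamplesTape Q → SamplesTape fun n => P n + Q n := by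
    rintro P Q ⟨G, g, hG, hg, hG'⟩ ⟨H, h, hH, hh, hH'⟩
    refine ⟨fun x => (H x).bind G, h + g, ?_, ?_, ?_⟩
    · obtain ⟨p, hp, hp'⟩ := hG
      obtain ⟨q, hq, hq'⟩ := hH
      exact ⟨.seq q p, hq.seq hp, fun x => by rw [output_seq, hq', show output p = G from funext hp']⟩
    · intro x o ho
      obtain ⟨y, hy, ho⟩ := (PMF.mem_support_bind_iff _ _ _).1 ho
      have h1 := hh _ _ hy
      have h2 := hg _ _ ho
      rw [h1.1] at h2
      refine ⟨h2.1, ?_⟩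
      rw [Polynomial.eval_add]
      omega
    · intro a s
      simp only [hH', tape_add]
      simp only [PMF.map_bind, PMF.bind_map, PMF.map_comp, Function.comp_def, hG',
        List.append_assoc]
  induction P using Polynomial.induction_on' with
  | add P Q hP hQ => simpa only [Polynomial.eval_add] using hadd _ _ hP hQ
  | monomial n k =>
    induction n with
    | zero =>
      induction k with
      | zero => simpa using hzero
      | succ k ih =>
        simp only [Polynomial.eval_monomial, pow_zero, mul_one] at ih ⊢
        refine hadd (fun _ => k) (fun _ => 1) ih ⟨fun x => (PMF.uniformOfFintype Bool).bind fun b =>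
          PMF.pure (cons x.fst (cons (ofBit b) x.snd)), Polynomial.C 6, ?_, ?_, ?_⟩
        · refine Eff.bind (d := ofBit) ⟨.flip, PPT_flip, fun x => output_flip _⟩ ?_
          have j := Det.input (c := fun a : Data × Bool => cons a.1 (ofBit a.2))
          exact j.fst.fst.cons (j.snd.cons j.fst.snd)
        · intro x o ho
          obtain ⟨b, _, ho⟩ := (PMF.mem_support_bind_iff _ _ _).1 ho
          simp at ho
          subst ho
          refine ⟨rfl, ?_⟩
          have h4 : x.fst.size + x.snd.size ≤ x.size + 1 := by
            cases x <;> simp [Data.fst, Data.snd, Data.size]; omega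
          have h5 : (ofBit b).size ≤ 3 := by cases b <;> simp [ofBit, Data.size]
          simp only [Data.size, Polynomial.eval_C]
          omega
        · intro a s
          rw [show (1 : ℕ) = 0 + 1 from rfl, tape_succ, tape_zero]
          simp [PMF.map_bind, PMF.pure_map, ofStr_cons]
    | succ n ih =>
      obtain ⟨G, g, hG, hg, hG'⟩ := ih
      refine ⟨fun d => kiter G d.fst.len d, Polynomial.X * g, hG.loop_fst hg, ?_, ?_⟩
      · have key : ∀ m x, ∀ o ∈ (kiter G m x).support,
            o.fst = x.fst ∧ o.size ≤ x.size + m * g.eval x.fst.size := by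
          intro m
          induction m with
          | zero => intro x o ho; simp [kiter] at ho; simp [ho]
          | succ m ih =>
            intro x o ho
            obtain ⟨y, hy, ho⟩ := (PMF.mem_support_bind_iff _ _ _).1 ho
            have h1 := hg _ _ hy
            have h2 := ih _ _ ho
            rw [h1.1] at h2
            refine ⟨h2.1, ?_⟩
            rw [add_mul]
            omega
        intro x o ho
        have h1 := key _ _ _ ho
        refine ⟨h1.1, h1.2.trans ?_⟩
        rw [Polynomial.eval_mul, Polynomial.eval_X]
        have := Data.len_le_size x.fst
        gcongr
      · have key : ∀ m a s, kiter G m (cons a (ofStr s)) =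
            (tape (m * (Polynomial.monomial n k).eval a.len)).map
              fun t => cons a (ofStr (t ++ s)) := by
          intro m
          induction m with
          | zero => intro a s; simp [kiter, tape_zero, PMF.pure_map]
          | succ m ih =>
            intro a s
            rw [kiter, hG', add_mul, one_mul, tape_add]
            simp only [PMF.map_bind, PMF.bind_map, PMF.map_comp, Function.comp_def, ih,
              List.append_assoc]
        intro a s
        simp only [Data.fst_cons, key]
        congr 2
        simp only [Polynomial.eval_monomial]
        ring

theorem Eff.tape (P : Polynomial ℕ) {t : Γ → Data} (ht : Det c t) :
    Eff c fun γ => (tape (P.eval (t γ).len)).map ofStr := by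
  obtain ⟨G, g, hG, -, hG'⟩ := samplesTape P
  have h := Eff.comp hG (fun γ => cons (t γ) (ofStr [])) (ht.cons (Det.const _))
  obtain ⟨p, hp, hp'⟩ := h
  refine ⟨.seq p .snd, hp.seq PPT_snd, fun γ => ?_⟩
  rw [output_seq, hp', funext output_snd]
  simp [hG', map_pure_eq_bind]

end Tape

/-! ## Sequences of independent samples -/

/-- Independent samples from the laws `F a`, where `a` runs through a list. -/
def seqD {ι : Type} : List ι → (ι → PMF Data) → PMF Data
  | [], _ => PMF.pure nil
  | a :: l, F => (F a).bind fun x => (seqD l F).map (cons x)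

theorem Eff.seqD {ι Γ : Type} {c : Γ → Data} {F : Γ → ι → PMF Data} (hF : ∀ a, Eff c fun γ => F γ a)
    (l : List ι) : Eff c fun γ => seqD l (F γ) := by
  induction l with
  | nil => exact Det.const _
  | cons a l ih =>
    refine Eff.bind (d := fun d => d) (by simpa only [map_id_fun] using hF a) ?_
    have j := Det.input (c := fun a : Γ × Data => cons (c a.1) a.2)
    have := ih.comp (c := fun a : Γ × Data => cons (c a.1) a.2) Prod.fst j.fst
    refine Eff.bind (F := fun a : Γ × Data => PIC.seqD l (F a.1)) (G := fun a b => PMF.pure (cons a.2 b))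
      (d := fun d => d) (by simpa only [map_id_fun] using this) ?_
    have j := Det.input (c := fun a : (Γ × Data) × Data => cons (cons (c a.1.1) a.1.2) a.2)
    exact j.fst.snd.cons j.snd

theorem seqD_congr {ι : Type} {l : List ι} {F G : ι → PMF Data} (h : ∀ a ∈ l, F a = G a) :
    seqD l F = seqD l G := by
  induction l with
  | nil => rfl
  | cons a l ih =>
    rw [seqD, seqD, h a (by simp), ih fun b hb => h b (by simp [hb])]

/-- Independence lets component `v` be drawn first and then frozen. The reduction to IND-CPA
security plants its challenge this way. -/
theorem seqD_eq_bind_update {ι : Type} [DecidableEq ι] {l : List ι} (hl : l.Nodup)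
    (F : ι → PMF Data) (v : ι) :
    seqD l F = (F v).bind fun a => seqD l (Function.update F v (PMF.pure a)) := by
  induction l with
  | nil => simp [seqD]
  | cons u l ih =>
    obtain ⟨hu, hl⟩ := List.nodup_cons.1 hl
    by_cases h : u = v
    · subst h
      simp only [seqD, Function.update_self, PMF.pure_bind]
      congr 1
      funext a
      congr 1
      exact seqD_congr fun b hb => (Function.update_of_ne (by rintro rfl; exact hu hb) _ _).symm
    · simp only [seqD, Function.update_of_ne h]
      rw [PMF.bind_comm]
      congr 1
      funext a
      rw [ih hl, PMF.map_bind]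

theorem seqD_pure {ι : Type} (l : List ι) (g : ι → Data) :
    seqD l (fun a => PMF.pure (g a)) = PMF.pure (ofList (l.map g)) := by
  induction l with
  | nil => rfl
  | cons a l ih => simp [seqD, ih, PMF.pure_map, ofList]

section indep

variable {ι : Type} [Fintype ι] [DecidableEq ι] {α : ι → Type} [∀ i, Fintype (α i)]

theorem indep_apply (p : ∀ i, PMF (α i)) (g : ∀ i, α i) : indep p g = ∏ i, p i (g i) := rfl

/-- Resampling one coordinate does not change an independent family. -/
theorem indep_eq_bind_update (p : ∀ i, PMF (α i)) (u : ι) :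
    indep p = (p u).bind fun a => (indep p).map fun g => Function.update g u a := by
  classical
  ext h
  simp only [PMF.bind_apply, PMF.map_apply, tsum_fintype]
  -- Resampling leads to `h` exactly if the new value is `h u` and the old family agrees with `h`
  -- away from `u`; its old value at `u` is free and sums out.
  have h1 : ∀ (a : α u) (g : ∀ i, α i), h = Function.update g u a ↔
      a = h u ∧ g = Function.update h u (g u) := by
    intro a g
    constructor
    · rintro rfl; simp
    · rintro ⟨rfl, hg⟩
      rw [hg]; simp
  have h2 : ∀ a : α u, (∑ g, if h = Function.update g u a then indep p g else 0) =
      if a = h u then ∏ i ∈ Finset.univ.erase u, p i (h i) else 0 := by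
    intro a
    split_ifs with ha
    · subst ha
      simp only [h1, true_and]
      rw [← Finset.sum_filter]
      have : Finset.univ.filter (fun g : ∀ i, α i => g = Function.update h u (g u)) =
          Finset.univ.image fun b => Function.update h u b := by
        ext g
        simp only [Finset.mem_filter, Finset.mem_univ, true_and, Finset.mem_image]
        constructor
        · intro hg; exact ⟨g u, hg.symm⟩
        · rintro ⟨b, rfl⟩; simp
      rw [this, Finset.sum_image (fun a _ b _ hab => Function.update_injective h u hab)]
      have h3 : ∀ b, indep p (Function.update h u b) =
          p u b * ∏ i ∈ Finset.univ.erase u, p i (h i) := by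
        intro b
        rw [indep_apply, ← Finset.mul_prod_erase _ _ (Finset.mem_univ u), Function.update_self]
        congr 1
        refine Finset.prod_congr rfl fun i hi => ?_
        rw [Function.update_of_ne (Finset.ne_of_mem_erase hi)]
      simp only [h3]
      rw [← Finset.sum_mul, ← tsum_fintype (L := .unconditional _), (p u).tsum_coe, one_mul]
    · exact Finset.sum_eq_zero fun g _ => if_neg fun hg => ha ((h1 a g).1 hg).1
  calc indep p h = ∑ a, p u a * if a = h u then ∏ i ∈ Finset.univ.erase u, p i (h i) else 0 := by
        simp only [mul_ite, mul_zero, Finset.sum_ite_eq', Finset.mem_univ, if_true]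
        rw [indep_apply, ← Finset.mul_prod_erase _ _ (Finset.mem_univ u)]
    _ = _ := Finset.sum_congr rfl fun a _ => by rw [← h2 a]; congr!

/-- If coordinate `σ v` of an independent family determines the law of sample `v`, then the samples
are independent. -/
theorem indep_bind_seqD (p : ∀ i, PMF (α i)) {κ : Type} {σ : κ → ι} (hσ : Function.Injective σ)
    (K : ∀ v, α (σ v) → PMF Data) {l : List κ} (hl : l.Nodup) :
    ((indep p).bind fun g => seqD l fun v => K v (g (σ v))) =
      seqD l fun v => (p (σ v)).bind (K v) := by
  induction l with
  | nil => simp [seqD]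
  | cons v l ih =>
    obtain ⟨hv, hl⟩ := List.nodup_cons.1 hl
    have h : ∀ (g : ∀ i, α i) (a : α (σ v)),
        (seqD l fun w => K w (Function.update g (σ v) a (σ w))) =
          seqD l fun w => K w (g (σ w)) := fun g a => seqD_congr fun w hw => by
      rw [Function.update_of_ne]
      intro e
      exact hv (hσ e ▸ hw)
    -- Coordinate `σ v` is drawn afresh for the head. By injectivity of `σ` and `v ∉ l`, the tail
    -- never reads it.
    rw [indep_eq_bind_update p (σ v)]
    simp only [seqD, PMF.bind_bind, PMF.bind_map, Function.comp_def, Function.update_self, h]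
    congr 1
    funext a
    rw [PMF.bind_comm]
    simp only [← ih hl, PMF.map_bind]

end indep

/-! ## Negligible functions and acceptance probabilities -/

theorem Negligible.zero : Negligible fun _ => 0 := Asymptotics.superpolynomialDecay_zero _ _

theorem Negligible.add {f g : ℕ → ℝ} (hf : Negligible f) (hg : Negligible g) :
    Negligible fun κ => f κ + g κ := Asymptotics.SuperpolynomialDecay.add hf hg

theorem Negligible.sum {ι : Type*} (s : Finset ι) {f : ι → ℕ → ℝ}
    (hf : ∀ i ∈ s, Negligible (f i)) : Negligible fun κ => ∑ i ∈ s, f i κ := by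
  classical
  induction s using Finset.induction_on with
  | empty => simpa using Negligible.zero
  | insert a s ha ih =>
    simp only [Finset.sum_insert ha]
    exact (hf a (by simp)).add (ih fun i hi => hf i (by simp [hi]))

/-- The probability of `true`. -/
def prTrue (p : PMF Bool) : ℝ := (p true).toReal

theorem bind_congr_support {α β : Type} (p : PMF α) {F G : α → PMF β}
    (h : ∀ a ∈ p.support, F a = G a) : p.bind F = p.bind G := by
  ext b
  simp only [PMF.bind_apply]
  refine tsum_congr fun a => ?_
  by_cases ha : a ∈ p.support
  · rw [h a ha]
  · rw [(PMF.apply_eq_zero_iff p a).2 ha, zero_mul, zero_mul]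

/-- Identical until bad: outside `B` the two experiments coincide, and on `B` each accepts with
probability at most one. -/
theorem abs_prTrue_bind_sub_le {α : Type} (p : PMF α) {F G : α → PMF Bool} {B : α → Prop}
    [DecidablePred B] (h : ∀ a, ¬ B a → F a = G a) :
    |prTrue (p.bind F) - prTrue (p.bind G)| ≤ prTrue (p.map fun a => decide (B a)) := by
  have key : ∀ F G : α → PMF Bool, (∀ a, ¬ B a → F a = G a) →
      prTrue (p.bind F) ≤ prTrue (p.bind G) + prTrue (p.map fun a => decide (B a)) := by
    intro F G h
    unfold prTrue
    rw [← ENNReal.toReal_add (PMF.apply_ne_top _ _) (PMF.apply_ne_top _ _)]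
    refine ENNReal.toReal_mono (ENNReal.add_ne_top.2 ⟨PMF.apply_ne_top _ _, PMF.apply_ne_top _ _⟩) ?_
    rw [map_pure_eq_bind, PMF.bind_apply, PMF.bind_apply, PMF.bind_apply, ← ENNReal.tsum_add]
    refine ENNReal.tsum_le_tsum fun a => ?_
    rw [← mul_add]
    gcongr
    by_cases ha : B a
    · simp only [ha, decide_true, PMF.pure_apply, if_true]
      exact (PMF.coe_le_one _ _).trans le_add_self
    · rw [h a ha]
      exact le_self_add
  rw [abs_sub_le_iff]
  exact ⟨by linarith [key F G h], by linarith [key G F fun a ha => (h a ha).symm]⟩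

/-- Union bound. -/
theorem prTrue_map_exists_le {α ι : Type} (p : PMF α) (s : Finset ι) (B : ι → α → Prop)
    [∀ i, DecidablePred (B i)] [DecidablePred fun a => ∃ i ∈ s, B i a] :
    prTrue (p.map fun a => decide (∃ i ∈ s, B i a)) ≤
      ∑ i ∈ s, prTrue (p.map fun a => decide (B i a)) := by
  unfold prTrue
  rw [← ENNReal.toReal_sum fun i _ => PMF.apply_ne_top _ _]
  refine ENNReal.toReal_mono (ENNReal.sum_ne_top.2 fun i _ => PMF.apply_ne_top _ _) ?_
  simp only [map_pure_eq_bind, PMF.bind_apply]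
  rw [← Summable.tsum_finsetSum fun i _ => ENNReal.summable]
  refine ENNReal.tsum_le_tsum fun a => ?_
  rw [← Finset.mul_sum]
  gcongr
  by_cases h : ∃ i ∈ s, B i a
  · obtain ⟨i, hi, hB⟩ := h
    refine le_trans ?_ (Finset.single_le_sum (fun _ _ => zero_le) hi)
    simp only [hB, decide_true, PMF.pure_apply, if_true]
    split_ifs <;> simp
  · simp [h]

/-- The weights of a mixture are at most one and are simply dropped. The loss is affordable because
the sum will run over finite types that do not depend on the security parameter. -/
theorem abs_prTrue_bind_sub_le_sum {α : Type} [Fintype α] (p : PMF α) (F G : α → PMF Bool) :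
    |prTrue (p.bind F) - prTrue (p.bind G)| ≤ ∑ a, |prTrue (F a) - prTrue (G a)| := by
  have h : ∀ F : α → PMF Bool, prTrue (p.bind F) = ∑ a, (p a).toReal * prTrue (F a) := by
    intro F
    unfold prTrue
    rw [PMF.bind_apply, tsum_fintype, ENNReal.toReal_sum fun a _ =>
      ENNReal.mul_ne_top (PMF.apply_ne_top _ _) (PMF.apply_ne_top _ _)]
    simp only [ENNReal.toReal_mul]
  rw [h, h, ← Finset.sum_sub_distrib]
  refine (Finset.abs_sum_le_sum_abs _ _).trans (Finset.sum_le_sum fun a _ => ?_)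
  rw [← mul_sub, abs_mul, abs_of_nonneg ENNReal.toReal_nonneg]
  refine mul_le_of_le_one_left (abs_nonneg _) ?_
  exact ENNReal.toReal_le_of_le_ofReal zero_le_one (by simpa using PMF.coe_le_one p a)

/-! ## Consequences of IND-CPA security -/

theorem mem_support_tape {k : ℕ} {s : List Bool} (h : s ∈ (tape k).support) :
    ∃ v : Bits k, str v = s := by
  rw [tape, PMF.support_map] at h
  obtain ⟨v, _, rfl⟩ := h
  exact ⟨v, rfl⟩

/-- Trades bit vectors, whose type may depend on earlier samples, for plain strings. -/
theorem coins_bind_str {α : Type} (k : ℕ) (F : List Bool → PMF α) :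
    (coins k).bind (fun v => F (str v)) = (tape k).bind F := by
  rw [tape, PMF.bind_map]; rfl

variable {Γ : Type} {c : Γ → Data}

theorem PKE.det_gen (E : PKE) {k : Γ → ℕ} {r : Γ → List Bool} (hk : Det c fun γ => unary (k γ))
    (hr : Det c fun γ => ofStr (r γ)) : Det c fun γ =>
      cons (ofStr (E.gen (k γ) (r γ)).1) (ofStr (E.gen (k γ) (r γ)).2) := by
  obtain ⟨p, hp, hp'⟩ := E.gen_poly
  have h : Det (fun a : ℕ × List Bool => cons (unary a.1) (ofStr a.2)) fun a =>
      cons (ofStr (E.gen a.1 a.2).1) (ofStr (E.gen a.1 a.2).2) := ⟨p, hp, fun a => hp' a.1 a.2⟩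
  exact h.comp (fun γ => (k γ, r γ)) (hk.cons hr)

theorem PKE.det_enc (E : PKE) {pk m r : Γ → List Bool} (hpk : Det c fun γ => ofStr (pk γ))
    (hm : Det c fun γ => ofStr (m γ)) (hr : Det c fun γ => ofStr (r γ)) :
    Det c fun γ => ofStr (E.enc (pk γ) (m γ) (r γ)) := by
  obtain ⟨p, hp, hp'⟩ := E.enc_poly
  have h : Det (fun a : List Bool × List Bool × List Bool =>
      cons (ofStr a.1) (cons (ofStr a.2.1) (ofStr a.2.2))) fun a =>
      ofStr (E.enc a.1 a.2.1 a.2.2) := ⟨p, hp, fun a => hp' a.1 a.2.1 a.2.2⟩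
  exact h.comp (fun γ => (pk γ, m γ, r γ)) (hpk.cons (hm.cons hr))

theorem PKE.det_dec (E : PKE) {sk m : Γ → List Bool} (hsk : Det c fun γ => ofStr (sk γ))
    (hm : Det c fun γ => ofStr (m γ)) :
    Det c fun γ => ofOption ofStr (E.dec (sk γ) (m γ)) := by
  obtain ⟨p, hp, hp'⟩ := E.dec_poly
  have h : Det (fun a : List Bool × List Bool => cons (ofStr a.1) (ofStr a.2)) fun a =>
      ofOption ofStr (E.dec a.1 a.2) := ⟨p, hp, fun a => hp' a.1 a.2⟩
  exact h.comp (fun γ => (sk γ, m γ)) (hsk.cons hm)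

theorem len_unary (k : ℕ) : (unary k).len = k := by simp [unary, len_ofStr]

theorem PKE.eff_genTape (E : PKE) {k : Γ → ℕ} (hk : Det c fun γ => unary (k γ)) :
    Eff c fun γ => (tape (E.genLen.eval (k γ))).map ofStr := by
  simpa only [len_unary] using Eff.tape E.genLen hk

/-- The concatenation of key and message is used only as a datum of the right length. -/
theorem PKE.eff_encTape (E : PKE) {pk m : Γ → List Bool} (hpk : Det c fun γ => ofStr (pk γ))
    (hm : Det c fun γ => ofStr (m γ)) :
    Eff c fun γ => (tape (E.encLen.eval ((pk γ).length + (m γ).length))).map ofStr := by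
  simpa only [len_ofStr, List.length_append, List.length_reverse] using
    Eff.tape E.encLen (hpk.revAppend hm)

/-- The law of the output bit of `G`, given a public key and an encryption of `m`. -/
def PKE.encGame (E : PKE) (G : ℕ × List Bool × List Bool → PMF Data) (m : List Bool) (κ : ℕ) :
    PMF Bool :=
  (tape (E.genLen.eval κ)).bind fun r =>
    (tape (E.encLen.eval ((E.gen κ r).1.length + m.length))).bind fun e =>
      (G (κ, (E.gen κ r).1, E.enc (E.gen κ r).1 m e)).map toBit

/-- No efficient test distinguishes encryptions of two fixed messages of the same length. -/
theorem PKE.INDCPA.encGame {E : PKE} (hE : E.INDCPA) {G : ℕ × List Bool × List Bool → PMF Data}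
    (hG : Eff (fun a => cons (cons (unary a.1) (ofStr a.2.1)) (ofStr a.2.2)) G)
    {m₀ m₁ : List Bool} (hm : m₀.length = m₁.length) :
    Negligible fun κ => |prTrue (E.encGame G m₁ κ) - prTrue (E.encGame G m₀ κ)| := by
  have j := Det.input (c := fun a : ℕ × List Bool => cons (unary a.1) (ofStr a.2))
  -- The first stage outputs the two fixed messages and hands its whole input on as state.
  obtain ⟨p, hp, hp'⟩ := (Det.const (ofStr m₀)).cons ((Det.const (ofStr m₁)).cons j)
  obtain ⟨q, hq, hq'⟩ := hG
  have key : ∀ (b : Bool) (κ : ℕ),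
      E.cpaExp p q b κ = E.encGame G (if b then m₁ else m₀) κ := by
    intro b κ
    have h1 := fun pk : List Bool => hp' (κ, pk)
    have h2 := fun pk ct : List Bool => hq' (κ, pk, ct)
    simp only at h1 h2
    simp only [PKE.cpaExp, PKE.encGame, PKE.genTape, bind, pure, h1, PMF.pure_bind,
      Data.fst_cons, Data.snd_cons, toStr_ofStr, hm, if_true, h2]
    rw [← coins_bind_str]
    congr 1
    funext r
    refine (coins_bind_str _ fun e => (G (κ, (E.gen κ (str r)).1,
      E.enc (E.gen κ (str r)).1 (if b then m₁ else m₀) e)).map toBit).trans ?_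
    simp only [toStr_ofStr]
  have := hE p q hp hq
  simpa only [key, if_true, Bool.false_eq_true, if_false, prTrue] using this

/-- The probability that two independent runs of key generation output the same public key. -/
def PKE.collision (E : PKE) (κ : ℕ) : ℝ :=
  prTrue ((tape (E.genLen.eval κ)).bind fun r => (tape (E.genLen.eval κ)).map fun r' =>
    decide ((E.gen κ r).1 = (E.gen κ r').1))

theorem PKE.dec_enc (E : PKE) {κ : ℕ} {r m e : List Bool}
    (hr : r ∈ (tape (E.genLen.eval κ)).support)
    (he : e ∈ (tape (E.encLen.eval ((E.gen κ r).1.length + m.length))).support) :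
    E.dec (E.gen κ r).2 (E.enc (E.gen κ r).1 m e) = some m := by
  obtain ⟨v, rfl⟩ := mem_support_tape hr
  obtain ⟨w, rfl⟩ := mem_support_tape he
  exact E.correct κ v m w

/-- The test draws its own key pair and, if the public key equals the given one, decrypts the
challenge and accepts on `[true]`. On encryptions of `[true]` it accepts with exactly the collision
probability, on encryptions of `[false]` never, so its advantage is that probability. -/
theorem PKE.INDCPA.collision {E : PKE} (hE : E.INDCPA) : Negligible E.collision := by
  let G : ℕ × List Bool × List Bool → PMF Data := fun a =>
    (tape (E.genLen.eval a.1)).bind fun r' => PMF.pure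
      (if (ofBit (decide (a.2.1 = (E.gen a.1 r').1))).toBit then
        ofBit (decide (ofOption ofStr (E.dec (E.gen a.1 r').2 a.2.2) =
          ofOption ofStr (some [true]))) else nil)
  have hG : Eff (fun a => cons (cons (unary a.1) (ofStr a.2.1)) (ofStr a.2.2)) G := by
    have j := Det.input
      (c := fun a : ℕ × List Bool × List Bool => cons (cons (unary a.1) (ofStr a.2.1)) (ofStr a.2.2))
    refine Eff.bind (d := ofStr) (E.eff_genTape j.fst.fst) ?_
    have j := Det.input (c := fun b : (ℕ × List Bool × List Bool) × List Bool =>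
      cons (cons (cons (unary b.1.1) (ofStr b.1.2.1)) (ofStr b.1.2.2)) (ofStr b.2))
    have g := E.det_gen (k := fun b : (ℕ × List Bool × List Bool) × List Bool => b.1.1)
      j.fst.fst.fst j.snd
    exact Det.cond (Det.eqStr j.fst.fst.snd g.fst)
      (Det.eq_const (E.det_dec g.snd j.fst.snd) _) (Det.const nil)
  have hinj : ∀ o : Option (List Bool),
      (ofOption ofStr o = ofOption ofStr (some [true])) = (o = some [true]) := by
    intro o
    cases o with
    | none => simp [ofOption]
    | some s => simp [ofOption, ofStr_injective.eq_iff]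
  have h1 : ∀ κ, prTrue (E.encGame G [true] κ) = E.collision κ := by
    intro κ
    unfold PKE.encGame PKE.collision
    congr 2
    funext r
    rw [← PMF.bind_const (tape (E.encLen.eval ((E.gen κ r).1.length + [true].length)))
      ((tape (E.genLen.eval κ)).map _)]
    refine bind_congr_support _ fun e he => ?_
    rw [PMF.map_bind]
    refine bind_congr_support _ fun r' hr' => ?_
    rw [PMF.pure_map, Function.comp_apply]
    congr 1
    by_cases h : (E.gen κ r).1 = (E.gen κ r').1
    -- The challenge is also an encryption under the public key of the fresh pair, with a tape of
    -- the right length, so correctness of that pair applies.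
    · rw [h] at he
      simp [h, E.dec_enc hr' he]
    · simp [h]
  have h0 : ∀ κ, prTrue (E.encGame G [false] κ) = 0 := by
    intro κ
    have : E.encGame G [false] κ = PMF.pure false := by
      unfold PKE.encGame
      rw [← PMF.bind_const (tape (E.genLen.eval κ)) (PMF.pure false)]
      congr 1
      funext r
      rw [← PMF.bind_const (tape (E.encLen.eval ((E.gen κ r).1.length + [false].length)))
        (PMF.pure false)]
      refine bind_congr_support _ fun e he => ?_
      rw [PMF.map_bind, ← PMF.bind_const (tape (E.genLen.eval κ)) (PMF.pure false)]
      refine bind_congr_support _ fun r' hr' => ?_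
      rw [PMF.pure_map]
      congr 1
      by_cases h : (E.gen κ r).1 = (E.gen κ r').1
      · rw [h] at he
        simp [h, E.dec_enc hr' he, ofOption, ofStr_injective.eq_iff]
      · simp [h]
    simp [this, prTrue]
  have := hE.encGame hG (m₀ := [false]) (m₁ := [true]) rfl
  simp only [h1, h0, sub_zero] at this
  convert this using 2 with κ
  exact (abs_of_nonneg ENNReal.toReal_nonneg).symm

/-! ### The real execution conditioned on sanitized inputs and permutations -/

theorem initBits_append {k : ℕ} (s : List Bool) (v : Bits k) : initBits k (s ++ str v) = s := by
  simp [initBits, str]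

theorem lastBits_append {k : ℕ} (s : List Bool) (v : Bits k) : lastBits k (s ++ str v) = v := by
  funext t
  simp [lastBits, str]

/-- Only the law `F` depends on earlier draws. This brings the sanitized inputs and permutations to
the front of the protocol. -/
theorem bind_reorder {α β ξ π δ : Type} {ε : α → β → ξ → Type} (A : PMF α) (B : PMF β) (X : PMF ξ)
    (F : ∀ a b x, PMF (ε a b x)) (P : PMF π) (K : ∀ a b x, ε a b x → π → PMF δ) :
    (A.bind fun a => B.bind fun b => X.bind fun x => (F a b x).bind fun e => P.bind fun p =>
      K a b x e p) =
    X.bind fun x => P.bind fun p => B.bind fun b => A.bind fun a => (F a b x).bind fun e =>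
      K a b x e p := by
  simp only [PMF.bind_comm (F _ _ _) P]
  simp only [PMF.bind_comm B X]
  simp only [PMF.bind_comm B P]
  rw [PMF.bind_comm A X]
  simp only [PMF.bind_comm A P, PMF.bind_comm A B]

namespace Setup

variable {S : Setup}

theorem owner_position (π : S.Perms) (u : S.User) : owner π (position π u) = u :=
  Sigma.ext rfl (heq_of_eq (Equiv.apply_symm_apply _ _))

theorem position_owner (π : S.Perms) (v : S.User) : position π (owner π v) = v :=
  Sigma.ext rfl (heq_of_eq (Equiv.symm_apply_apply _ _))

theorem owner_injective (π : S.Perms) : Function.Injective (owner π) :=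
  Function.LeftInverse.injective (position_owner π)

/-- The view of the adversary as a function of all the random choices; `r` and `e` are the tapes of
the users, `es` are the tapes of the server, indexed by positions. -/
def viewOf (E : PKE) (C : Finset S.Party) (x : S.Inputs) (κ : ℕ) (xs : S.Sanitized) (π : S.Perms)
    (y : S.Results) (rc : List Bool) (r e es : S.User → List Bool) : Data :=
  ofList
    [ ofStr (E.gen κ rc).1,
      code fun v => cons (ofStr (E.gen κ (r (owner π v))).1)
        (ofStr (E.enc (E.gen κ (r (owner π v))).1 (str (y v)) (es v))),
      codeOn C fun u => ofList
        [ofStr (str (x u)), ofStr (str (xs u)), ofStr (r u), ofStr (e u)],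
      ifServer C (ofList
        [ofStr rc, code fun v => ofStr (E.enc (E.gen κ rc).1
            ((E.gen κ (r (owner π v))).1 ++ str (xs (owner π v))) (e (owner π v))),
          codeLeak (leak C π), code fun v => ofStr (es v)]) ]

/-- The execution of the protocol for fixed sanitized inputs and permutations, where the outputs of
the users are `out r es`. -/
def fixedExec (E : PKE) (C : Finset S.Party) (x : S.Inputs) (κ : ℕ) (xs : S.Sanitized)
    (π : S.Perms) (y : S.Results)
    (out : (S.User → List Bool) → (S.User → List Bool) → S.User → Option (List Bool))
    (r : S.User → Bits (E.genLen.eval κ)) : PMF Data :=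
  (E.genTape κ).bind fun rc =>
    (indep fun u : S.User => E.encTape (E.gen κ (str rc)).1
      ((E.gen κ (str (r u))).1 ++ str (xs u))).bind fun e =>
    (indep fun v : S.User => E.encTape (E.gen κ (str (r (owner π v)))).1 (str (y v))).bind fun es =>
      PMF.pure (cons (viewOf E C x κ xs π y (str rc) (fun u => str (r u)) (fun u => str (e u))
        fun v => str (es v)) (codeOutputs (out (fun u => str (r u)) fun v => str (es v))
          (fun v => xs (owner π v)) y))

/-- What the users output at the end of the protocol. -/
def retrieved (E : PKE) (κ : ℕ) (π : S.Perms) (y : S.Results)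
    (r es : S.User → List Bool) (u : S.User) : Option (List Bool) :=
  retrieve E (E.gen κ (r u)) (fun v => ((E.gen κ (r (owner π v))).1,
    E.enc (E.gen κ (r (owner π v))).1 (str (y v)) (es v))) u

/-- The last part of the protocol, as a function of the data that the server has decrypted. -/
def publish (E : PKE) (f : S.Sanitized → S.Results) (key : S.User → List Bool × List Bool)
    (V : (S.User → List Bool × List Bool) → (S.User → List Bool) → Data)
    (pkAt : S.User → List Bool) (L : S.Sanitized) : PMF Data :=
  (indep fun v : S.User => E.encTape (pkAt v) (str (f L v))).bind fun es =>
    PMF.pure (cons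
      (V (fun v => (pkAt v, E.enc (pkAt v) (str (f L v)) (str (es v)))) fun v => str (es v))
      (codeOutputs (fun u => retrieve E (key u)
        (fun v => (pkAt v, E.enc (pkAt v) (str (f L v)) (str (es v)))) u) L (f L)))

/-- Perfect correctness gives the server the exact plaintexts, and the fixed length of the sanitized
input determines where the public key ends. The independent draws are then reordered. -/
theorem realExec_eq (E : PKE) (C : Finset S.Party) (f : S.Sanitized → S.Results) (x : S.Inputs)
    (κ : ℕ) : realExec E C f x κ =
      (indep fun u : S.User => S.R u.1 (x u)).bind fun xs =>
        (PMF.uniformOfFintype S.Perms).bind fun π =>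
          (indep fun _ : S.User => E.genTape κ).bind
            (fixedExec E C x κ xs π (f fun v => xs (owner π v))
              (retrieved E κ π (f fun v => xs (owner π v)))) := by
  let V : List Bool → (S.User → List Bool) → S.Sanitized → (S.User → List Bool) → S.Perms →
      (S.User → List Bool × List Bool) → (S.User → List Bool) → Data :=
    fun rc r xs e π board es => ofList
      [ ofStr (E.gen κ rc).1,
        code fun v => cons (ofStr (board v).1) (ofStr (board v).2),
        codeOn C fun u => ofList
          [ofStr (str (x u)), ofStr (str (xs u)), ofStr (r u), ofStr (e u)],
        ifServer C (ofList
          [ofStr rc, code fun v => ofStr (E.enc (E.gen κ rc).1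
            ((E.gen κ (r (owner π v))).1 ++ str (xs (owner π v))) (e (owner π v))),
            codeLeak (leak C π), code fun v => ofStr (es v)]) ]
  let plain : Bits (E.genLen.eval κ) → (S.User → Bits (E.genLen.eval κ)) → S.Sanitized →
      (S.User → List Bool) → S.Perms → S.User → List Bool := fun rc r xs e π v =>
    (E.dec (E.gen κ (str rc)).2 (E.enc (E.gen κ (str rc)).1 ((E.gen κ (str (r (owner π v)))).1 ++
      str (xs (owner π v))) (e (owner π v)))).getD []
  have h1 : realExec E C f x κ = (E.genTape κ).bind fun rc =>
      (indep fun _ : S.User => E.genTape κ).bind fun r =>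
      (indep fun u : S.User => S.R u.1 (x u)).bind fun xs =>
      (indep fun u : S.User => E.encTape (E.gen κ (str rc)).1
        ((E.gen κ (str (r u))).1 ++ str (xs u))).bind fun e =>
      (PMF.uniformOfFintype S.Perms).bind fun π =>
        publish E f (fun u => E.gen κ (str (r u)))
          (V (str rc) (fun u => str (r u)) xs (fun u => str (e u)) π)
          (fun v => initBits (S.sanLen v.1) (plain rc r xs (fun u => str (e u)) π v))
          (fun v => lastBits (S.sanLen v.1) (plain rc r xs (fun u => str (e u)) π v)) := by
    simp only [realExec, FShuffle, bind, PMF.bind_map]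
    rfl
  rw [h1, bind_reorder]
  congr 1
  funext xs
  congr 1
  funext π
  congr 1
  funext r
  unfold fixedExec
  congr 1
  funext rc
  congr 1
  funext e
  have h2 : ∀ v : S.User, plain rc r xs (fun u => str (e u)) π v =
      (E.gen κ (str (r (owner π v)))).1 ++ str (xs (owner π v)) := fun v => by
    simp only [plain, E.correct, Option.getD_some]
  have h3 : (fun v : S.User => initBits (S.sanLen v.1) (plain rc r xs (fun u => str (e u)) π v)) =
      fun v => (E.gen κ (str (r (owner π v)))).1 := funext fun v => by
    rw [h2]
    exact initBits_append _ _
  have h4 : (fun v : S.User => lastBits (S.sanLen v.1) (plain rc r xs (fun u => str (e u)) π v)) =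
      fun v => xs (owner π v) := funext fun v => by
    rw [h2]
    exact lastBits_append _ _
  -- In `publish` the decrypted data are arguments, so that the types of the server's tapes, which
  -- depend on them, are rewritten along with them.
  rw [h3, h4]
  rfl

/-- If the one-time public keys are distinct, then every user retrieves its own result. -/
theorem retrieved_eq (E : PKE) {κ : ℕ} (π : S.Perms) (y : S.Results)
    {r : S.User → Bits (E.genLen.eval κ)}
    (hr : ∀ u u', u ≠ u' → (E.gen κ (str (r u))).1 ≠ (E.gen κ (str (r u'))).1)
    (es : ∀ v, Bits (E.encLen.eval ((E.gen κ (str (r (owner π v)))).1.length +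
      (str (y v)).length))) :
    retrieved E κ π y (fun u => str (r u)) (fun v => str (es v)) =
      fun u => some (str (y (position π u))) := by
  funext u
  obtain ⟨i, k⟩ := u
  -- Naming the user by its position `p` turns the search into one for `p` itself.
  obtain ⟨p, rfl⟩ := (π i).surjective k
  have hp : position π ⟨i, π i p⟩ = ⟨i, p⟩ := position_owner π ⟨i, p⟩
  have h : ∀ j : Fin (S.n i), ((E.gen κ (str (r ⟨i, π i j⟩))).1 =
      (E.gen κ (str (r ⟨i, π i p⟩))).1) ↔ j = p := by
    intro j
    refine ⟨fun hj => ?_, fun hj => by rw [hj]⟩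
    by_contra hne
    exact hr ⟨i, π i j⟩ ⟨i, π i p⟩ (fun e => hne ((π i).injective (by simpa using e))) hj
  have h1 : (List.finRange (S.n i)).find? (fun j => decide
      ((E.gen κ (str (r ⟨i, π i j⟩))).1 = (E.gen κ (str (r ⟨i, π i p⟩))).1)) = some p := by
    simp only [h]
    obtain ⟨a, ha⟩ : ∃ a, (List.finRange (S.n i)).find? (fun j => decide (j = p)) = some a := by
      rw [← Option.isSome_iff_exists, List.find?_isSome]
      exact ⟨p, List.mem_finRange _, by simp⟩
    have := List.find?_some ha
    simp only [decide_eq_true_eq] at this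
    rw [ha, this]
  rw [hp]
  calc retrieved E κ π y (fun u => str (r u)) (fun v => str (es v)) ⟨i, π i p⟩
      = (some p).bind fun j => E.dec (E.gen κ (str (r ⟨i, π i p⟩))).2
          (E.enc (E.gen κ (str (r ⟨i, π i j⟩))).1 (str (y ⟨i, j⟩)) (str (es ⟨i, j⟩))) := by
        rw [← h1]; rfl
    _ = some (str (y ⟨i, p⟩)) :=
        E.correct κ (r ⟨i, π i p⟩) (str (y ⟨i, p⟩)) (es ⟨i, p⟩)

/-! ## The view as a function of independent blocks, one for each position -/

/-- All users, or all positions, in some order. -/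
def users (S : Setup) : List S.User := Finset.univ.toList

theorem mem_users (v : S.User) : v ∈ users S := by simp [users]

theorem nodup_users : (users S).Nodup := Finset.nodup_toList _

/-- The entry of position `v` in a list that is ordered like `users`. -/
def entry (v : S.User) (d : Data) : Data := (Data.snd^[(users S).idxOf v] d).fst

theorem entry_ofList (g : S.User → Data) (v : S.User) :
    entry v (ofList ((users S).map g)) = g v := by
  have key : ∀ l : List S.User, v ∈ l →
      (Data.snd^[l.idxOf v] (ofList (l.map g))).fst = g v := by
    intro l
    induction l with
    | nil => simp
    | cons u l ih =>
      intro hv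
      by_cases h : u = v
      · subst h; simp [ofList]
      · rw [List.idxOf_cons_ne _ h, Function.iterate_succ_apply]
        exact ih ((List.mem_cons.1 hv).resolve_left fun e => h e.symm)
  exact key _ (mem_users v)

/-- The entry of the bulletin board that carries the ciphertext `ct` under the key `pk`. -/
def hiddenData (pk ct : List Bool) : Data := cons (cons (ofStr pk) (ofStr ct)) nil

/-- All that happens to the message at some position: `s` is the sanitized input and `m` is the
result at that position. -/
def openData (E : PKE) (κ : ℕ) (pkc s m r e es : List Bool) : Data :=
  ofList [cons (ofStr (E.gen κ r).1) (ofStr (E.enc (E.gen κ r).1 m es)), ofStr r, ofStr e,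
    ofStr (E.enc pkc ((E.gen κ r).1 ++ s) e), ofStr es]

/-- The law of `hiddenData`. -/
def hiddenBlock (E : PKE) (κ : ℕ) (m : List Bool) : PMF Data :=
  (tape (E.genLen.eval κ)).bind fun r =>
    (tape (E.encLen.eval ((E.gen κ r).1.length + m.length))).bind fun es =>
      PMF.pure (hiddenData (E.gen κ r).1 (E.enc (E.gen κ r).1 m es))

/-- The law of `openData`. -/
def openBlock (E : PKE) (κ : ℕ) (pkc s m : List Bool) : PMF Data :=
  (tape (E.genLen.eval κ)).bind fun r =>
    (tape (E.encLen.eval (pkc.length + ((E.gen κ r).1 ++ s).length))).bind fun e =>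
      (tape (E.encLen.eval ((E.gen κ r).1.length + m.length))).bind fun es =>
        PMF.pure (openData E κ pkc s m r e es)

/-- The adversary knows the plaintext of the result at position `v`. -/
abbrev Visible (C : Finset S.Party) (π : S.Perms) (v : S.User) : Prop :=
  none ∈ C ∨ some (owner π v) ∈ C

/-- What the adversary sees of position `v`, with the result replaced by `z v` where the adversary
does not know it. -/
def block (E : PKE) (C : Finset S.Party) (xs : S.Sanitized) (π : S.Perms) (y : S.Results)
    (z : S.User → List Bool) (κ : ℕ) (pkc : List Bool) (v : S.User) : PMF Data :=
  if Visible C π v then openBlock E κ pkc (str (xs (owner π v))) (str (y v))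
  else hiddenBlock E κ (z v)

/-- The view as a function of the blocks. -/
def assemble (E : PKE) (C : Finset S.Party) (x : S.Inputs) (xs : S.Sanitized) (π : S.Perms)
    (κ : ℕ) (rc : List Bool) (d : Data) : Data :=
  ofList
    [ ofStr (E.gen κ rc).1,
      code fun v : S.User => (entry v d).fst,
      codeOn C fun u => ofList
        [ofStr (str (x u)), ofStr (str (xs u)), (entry (position π u) d).snd.fst,
          (entry (position π u) d).snd.snd.fst],
      ifServer C (ofList
        [ofStr rc, code fun v : S.User => (entry v d).snd.snd.snd.fst, codeLeak (leak C π),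
          code fun v : S.User => (entry v d).snd.snd.snd.snd.fst]) ]

/-- The law of a view with independent blocks. -/
def blockView (E : PKE) (C : Finset S.Party) (x : S.Inputs) (xs : S.Sanitized) (π : S.Perms)
    (κ : ℕ) (F : List Bool → S.User → PMF Data) : PMF Data :=
  (tape (E.genLen.eval κ)).bind fun rc =>
    (seqD (users S) (F rc)).map (assemble E C x xs π κ rc)

/-- The law of the view, with the unknown results replaced by `z`. -/
def viewLaw (E : PKE) (C : Finset S.Party) (x : S.Inputs) (xs : S.Sanitized) (π : S.Perms)
    (y : S.Results) (z : S.User → List Bool) (κ : ℕ) : PMF Data :=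
  blockView E C x xs π κ fun rc => block E C xs π y z κ (E.gen κ rc).1

theorem codeOn_congr {C : Finset S.Party} {g g' : S.User → Data}
    (h : ∀ u, some u ∈ C → g u = g' u) : codeOn C g = codeOn C g' := by
  unfold codeOn
  congr 1
  funext u
  split_ifs with hu
  · exact h u hu
  · rfl

theorem ifServer_congr {C : Finset S.Party} {d d' : Data} (h : none ∈ C → d = d') :
    ifServer C d = ifServer C d' := by
  unfold ifServer
  split_ifs with hC
  · exact h hC
  · rfl

/-- What the adversary sees of position `v`, as a function of the tapes. -/
def blockData (E : PKE) (C : Finset S.Party) (xs : S.Sanitized) (π : S.Perms) (y : S.Results)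
    (κ : ℕ) (pkc : List Bool) (v : S.User) (r e es : List Bool) : Data :=
  if Visible C π v then openData E κ pkc (str (xs (owner π v))) (str (y v)) r e es
  else hiddenData (E.gen κ r).1 (E.enc (E.gen κ r).1 (str (y v)) es)

/-- Tapes shown for a corrupted user belong to a visible position, and if the server is corrupted
every position is visible. So from a hidden block only the board entry is ever used; whatever else
`assemble` reads there is masked by `codeOn` or `ifServer`. -/
theorem viewOf_eq (E : PKE) (C : Finset S.Party) (x : S.Inputs) (κ : ℕ) (xs : S.Sanitized)
    (π : S.Perms) (y : S.Results) (rc : List Bool) (r e es : S.User → List Bool) :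
    viewOf E C x κ xs π y rc r e es = assemble E C x xs π κ rc (ofList ((users S).map fun v =>
      blockData E C xs π y κ (E.gen κ rc).1 v (r (owner π v)) (e (owner π v)) (es v))) := by
  have h1 : ∀ v r e es, (blockData E C xs π y κ (E.gen κ rc).1 v r e es).fst =
      cons (ofStr (E.gen κ r).1) (ofStr (E.enc (E.gen κ r).1 (str (y v)) es)) := by
    intro v r e es
    unfold blockData
    split_ifs <;> rfl
  have h2 : ∀ v r e es, Visible C π v → blockData E C xs π y κ (E.gen κ rc).1 v r e es =
      openData E κ (E.gen κ rc).1 (str (xs (owner π v))) (str (y v)) r e es :=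
    fun v r e es hv => if_pos hv
  unfold viewOf assemble
  simp only [entry_ofList, h1]
  congr 3
  congr 1
  · refine codeOn_congr fun u hu => ?_
    rw [h2 _ _ _ _ (Or.inr (by rwa [owner_position])), owner_position]
    rfl
  · congr 1
    refine ifServer_congr fun hC => ?_
    simp only [h2 _ _ _ _ (Or.inl hC)]
    rfl

/-- With outputs that ignore the tapes, the tapes belonging to a position enter only the block of
that position. Applying `indep_bind_seqD` to `r`, `e` and `es` in turn makes the blocks independent
for a fixed tape of the server's key; `r` and `e` are indexed by users, so `owner π` carries
positions to them. -/
theorem bind_fixedExec (E : PKE) (C : Finset S.Party) (x : S.Inputs) (κ : ℕ) (xs : S.Sanitized)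
    (π : S.Perms) (y : S.Results) (o : S.User → Option (List Bool)) :
    (indep fun _ : S.User => E.genTape κ).bind (fixedExec E C x κ xs π y fun _ _ => o) =
      (viewLaw E C x xs π y (fun v => str (y v)) κ).map fun w =>
        cons w (codeOutputs o (fun v => xs (owner π v)) y) := by
  have hblock : ∀ (pkc : List Bool) (v : S.User),
      ((E.genTape κ).bind fun r =>
        (E.encTape pkc ((E.gen κ (str r)).1 ++ str (xs (owner π v)))).bind fun e =>
        (E.encTape (E.gen κ (str r)).1 (str (y v))).bind fun es =>
          PMF.pure (blockData E C xs π y κ pkc v (str r) (str e) (str es))) =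
      block E C xs π y (fun v => str (y v)) κ pkc v := by
    intro pkc v
    unfold block blockData
    split_ifs with hv
    · unfold openBlock
      rw [← coins_bind_str]
      refine congrArg _ (funext fun r => ?_)
      rw [← coins_bind_str]
      refine congrArg _ (funext fun e => ?_)
      rw [← coins_bind_str]
      rfl
    · unfold hiddenBlock
      rw [← coins_bind_str]
      refine congrArg _ (funext fun r => ?_)
      -- A hidden block does not use the tape of the encryption to the server, which integrates out.
      rw [PMF.bind_const, ← coins_bind_str]
      rfl
  unfold fixedExec viewLaw blockView
  rw [PMF.bind_comm, PMF.map_bind, ← coins_bind_str]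
  refine congrArg _ (funext fun rc => ?_)
  simp only [viewOf_eq]
  rw [← funext (hblock (E.gen κ (str rc)).1)]
  rw [← indep_bind_seqD (fun _ : S.User => E.genTape κ) (owner_injective π)
    (fun v r => (E.encTape (E.gen κ (str rc)).1
        ((E.gen κ (str r)).1 ++ str (xs (owner π v)))).bind fun e =>
      (E.encTape (E.gen κ (str r)).1 (str (y v))).bind fun es =>
        PMF.pure (blockData E C xs π y κ (E.gen κ (str rc)).1 v (str r) (str e) (str es)))
    nodup_users]
  rw [PMF.map_bind, PMF.map_bind]
  refine congrArg _ (funext fun r => ?_)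
  rw [← indep_bind_seqD (fun u : S.User => E.encTape (E.gen κ (str rc)).1
      ((E.gen κ (str (r u))).1 ++ str (xs u))) (owner_injective π)
    (fun v e => (E.encTape (E.gen κ (str (r (owner π v)))).1 (str (y v))).bind fun es =>
        PMF.pure (blockData E C xs π y κ (E.gen κ (str rc)).1 v (str (r (owner π v))) (str e)
          (str es))) nodup_users]
  rw [PMF.map_bind, PMF.map_bind]
  refine congrArg _ (funext fun e => ?_)
  rw [← indep_bind_seqD (fun v : S.User => E.encTape (E.gen κ (str (r (owner π v)))).1 (str (y v)))
    (σ := fun v => v) (fun _ _ h => h)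
    (fun v es => PMF.pure (blockData E C xs π y κ (E.gen κ (str rc)).1 v (str (r (owner π v)))
      (str (e (owner π v))) (str es))) nodup_users]
  rw [PMF.map_bind, PMF.map_bind]
  refine congrArg _ (funext fun es => ?_)
  rw [seqD_pure, PMF.pure_map, PMF.pure_map]

/-- Up to collisions of the one-time public keys, the users output what they should. -/
theorem abs_retrieved_sub_le (E : PKE) (C : Finset S.Party) (x : S.Inputs) (κ : ℕ)
    (xs : S.Sanitized) (π : S.Perms) (y : S.Results) (A : Data → PMF Bool) :
    |prTrue (((indep fun _ : S.User => E.genTape κ).bind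
        (fixedExec E C x κ xs π y (retrieved E κ π y))).bind A) -
      prTrue (((indep fun _ : S.User => E.genTape κ).bind
        (fixedExec E C x κ xs π y fun _ _ u => some (str (y (position π u))))).bind A)| ≤
      ∑ _p ∈ (Finset.univ : Finset S.User).offDiag, E.collision κ := by
  classical
  rw [PMF.bind_bind, PMF.bind_bind]
  refine (abs_prTrue_bind_sub_le (B := fun r : S.User → Bits (E.genLen.eval κ) =>
    ∃ p ∈ (Finset.univ : Finset S.User).offDiag,
      (E.gen κ (str (r p.1))).1 = (E.gen κ (str (r p.2))).1) _ fun r hr => ?_).trans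
    ((prTrue_map_exists_le _ _ _).trans (Finset.sum_le_sum fun p hp => le_of_eq ?_))
  · congr 1
    unfold fixedExec
    refine congrArg _ (funext fun rc => congrArg _ (funext fun e => congrArg _ (funext fun es => ?_)))
    rw [retrieved_eq E π y (fun u u' huu' h => hr ⟨(u, u'), by simpa using huu', h⟩) es]
  · have hp' : p.1 ≠ p.2 := (Finset.mem_offDiag.1 hp).2.2
    -- Two distinct coordinates of the family are two independent runs of key generation.
    have h := indep_bind_seqD (fun _ : S.User => E.genTape κ) Function.injective_id
      (fun _ r => PMF.pure (ofStr (E.gen κ (str r)).1)) (l := [p.1, p.2]) (by simpa using hp')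
    have h' := congrArg (fun q => prTrue (q.map fun d => decide (d.fst = d.snd.fst))) h
    simp only [seqD_pure, id] at h'
    rw [PMF.map_bind] at h'
    simp only [PMF.pure_map, List.map_cons, ofList, Data.fst_cons, Data.snd_cons,
      ofStr_injective.eq_iff] at h'
    refine h'.trans ?_
    unfold PKE.collision
    simp only [seqD, PMF.map_bind, PMF.bind_bind, PMF.pure_bind, PMF.pure_map]
    simp only [Data.fst_cons, Data.snd_cons, ofStr_injective.eq_iff]
    rw [← coins_bind_str]
    simp only [map_pure_eq_bind]
    simp only [← coins_bind_str (E.genLen.eval κ)]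
    rfl

/-! ## Sampling the view efficiently -/

section Eff

variable {Γ : Type} {c : Γ → Data}

theorem det_code {g : Γ → S.User → Data} (hg : ∀ v, Det c fun γ => g γ v) :
    Det c fun γ => code (g γ) :=
  Det.ofFn fun i => Det.ofFn fun j => hg ⟨i, j⟩

theorem det_codeOn (C : Finset S.Party) {g : Γ → S.User → Data} (hg : ∀ v, Det c fun γ => g γ v) :
    Det c fun γ => codeOn C (g γ) :=
  det_code fun v => by
    split_ifs
    · exact hg v
    · exact Det.const _

theorem det_ifServer (C : Finset S.Party) {d : Γ → Data} (hd : Det c d) :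
    Det c fun γ => ifServer C (d γ) := by
  unfold ifServer
  split_ifs
  · exact hd
  · exact Det.const _

theorem det_entry (v : S.User) {d : Γ → Data} (hd : Det c d) : Det c fun γ => entry v (d γ) := by
  have key : ∀ k : ℕ, Det c fun γ => Data.snd^[k] (d γ) := by
    intro k
    induction k with
    | zero => exact hd
    | succ k ih =>
      simp only [Function.iterate_succ_apply']
      exact ih.snd
  exact (key _).fst

theorem det_assemble (E : PKE) (C : Finset S.Party) (x : S.Inputs) (xs : S.Sanitized)
    (π : S.Perms) {k : Γ → ℕ} {rc : Γ → List Bool} {d : Γ → Data}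
    (hk : Det c fun γ => unary (k γ)) (hrc : Det c fun γ => ofStr (rc γ)) (hd : Det c d) :
    Det c fun γ => assemble E C x xs π (k γ) (rc γ) (d γ) := by
  refine (E.det_gen hk hrc).fst.cons <| (det_code fun v => (det_entry v hd).fst).cons <|
    (det_codeOn C fun u => ?_).cons <| (det_ifServer C ?_).cons (Det.const nil)
  · exact (Det.const _).cons <| (Det.const _).cons <| (det_entry _ hd).snd.fst.cons <|
      (det_entry _ hd).snd.snd.fst.cons (Det.const nil)
  · exact hrc.cons <| (det_code fun v => (det_entry v hd).snd.snd.snd.fst).cons <|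
      (Det.const _).cons <| (det_code fun v => (det_entry v hd).snd.snd.snd.snd.fst).cons
        (Det.const nil)

theorem eff_blockView (E : PKE) (C : Finset S.Party) (x : S.Inputs) (xs : S.Sanitized)
    (π : S.Perms) {k : Γ → ℕ} {F : Γ → List Bool → S.User → PMF Data}
    (hk : Det c fun γ => unary (k γ))
    (hF : ∀ v, Eff (fun a : Γ × List Bool => cons (c a.1) (ofStr a.2)) fun a => F a.1 a.2 v) :
    Eff c fun γ => blockView E C x xs π (k γ) (F γ) := by
  refine Eff.bind (d := ofStr) (E.eff_genTape hk) ?_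
  have h := Eff.seqD (F := fun a : Γ × List Bool => F a.1 a.2) hF (users S)
  have j := Det.input (c := fun a : Γ × List Bool => cons (c a.1) (ofStr a.2))
  refine Eff.bind (F := fun a : Γ × List Bool => seqD (users S) (F a.1 a.2)) (d := fun d => d)
    (G := fun a d => PMF.pure (assemble E C x xs π (k a.1) a.2 d))
    (by simpa only [map_id_fun] using h) ?_
  have i := Det.input (c := fun b : (Γ × List Bool) × Data => cons (cons (c b.1.1) (ofStr b.1.2)) b.2)
  exact det_assemble E C x xs π (k := fun b : (Γ × List Bool) × Data => k b.1.1)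
    (rc := fun b => b.1.2) (hk.comp (fun b : (Γ × List Bool) × Data => b.1.1) i.fst.fst)
    i.fst.snd i.snd

theorem eff_hiddenBlock (E : PKE) {k : Γ → ℕ} (hk : Det c fun γ => unary (k γ)) (m : List Bool) :
    Eff c fun γ => hiddenBlock E (k γ) m := by
  refine Eff.bind (d := ofStr) (E.eff_genTape hk) ?_
  have i := Det.input (c := fun a : Γ × List Bool => cons (c a.1) (ofStr a.2))
  have hk' := hk.comp (fun a : Γ × List Bool => a.1) i.fst
  have hpk := (E.det_gen hk' i.snd).fst
  refine Eff.bind (Γ := Γ × List Bool) (d := ofStr) (E.eff_encTape hpk (Det.const (ofStr m)))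
    (G := fun a es => PMF.pure (hiddenData (E.gen (k a.1) a.2).1
      (E.enc (E.gen (k a.1) a.2).1 m es))) ?_
  have j := Det.input
    (c := fun b : (Γ × List Bool) × List Bool => cons (cons (c b.1.1) (ofStr b.1.2)) (ofStr b.2))
  have hpk' := hpk.comp (fun b : (Γ × List Bool) × List Bool => b.1) j.fst
  exact (hpk'.cons (E.det_enc hpk' (Det.const (ofStr m)) j.snd)).cons (Det.const nil)

theorem eff_openBlock (E : PKE) {k : Γ → ℕ} (hk : Det c fun γ => unary (k γ))
    {pkc : Γ → List Bool} (hpkc : Det c fun γ => ofStr (pkc γ)) (s m : List Bool) :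
    Eff c fun γ => openBlock E (k γ) (pkc γ) s m := by
  refine Eff.bind (d := ofStr) (E.eff_genTape hk) ?_
  have i := Det.input (c := fun a : Γ × List Bool => cons (c a.1) (ofStr a.2))
  have hpk := (E.det_gen (hk.comp (fun a : Γ × List Bool => a.1) i.fst) i.snd).fst
  have hmsg := hpk.append (Det.const (ofStr s))
  have hpkc' := hpkc.comp (fun a : Γ × List Bool => a.1) i.fst
  refine Eff.bind (Γ := Γ × List Bool) (d := ofStr) (E.eff_encTape hpkc' hmsg)
    (G := fun a e => (tape (E.encLen.eval ((E.gen (k a.1) a.2).1.length + m.length))).bind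
      fun es => PMF.pure (openData E (k a.1) (pkc a.1) s m a.2 e es)) ?_
  have i := Det.input
    (c := fun b : (Γ × List Bool) × List Bool => cons (cons (c b.1.1) (ofStr b.1.2)) (ofStr b.2))
  have hpk' := hpk.comp (fun b : (Γ × List Bool) × List Bool => b.1) i.fst
  refine Eff.bind (Γ := (Γ × List Bool) × List Bool) (d := ofStr)
    (E.eff_encTape hpk' (Det.const (ofStr m)))
    (G := fun b es => PMF.pure (openData E (k b.1.1) (pkc b.1.1) s m b.1.2 b.2 es)) ?_
  have i := Det.input (c := fun b : ((Γ × List Bool) × List Bool) × List Bool =>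
    cons (cons (cons (c b.1.1.1) (ofStr b.1.1.2)) (ofStr b.1.2)) (ofStr b.2))
  have h1 := hpk.comp (fun b : ((Γ × List Bool) × List Bool) × List Bool => b.1.1) i.fst.fst
  have h2 := hmsg.comp (fun b : ((Γ × List Bool) × List Bool) × List Bool => b.1.1) i.fst.fst
  have h3 := hpkc'.comp (fun b : ((Γ × List Bool) × List Bool) × List Bool => b.1.1) i.fst.fst
  exact (h1.cons (E.det_enc h1 (Det.const (ofStr m)) i.snd)).cons <| i.fst.fst.snd.cons <|
    i.fst.snd.cons <| (E.det_enc h3 h2 i.fst.snd).cons <| i.snd.cons (Det.const nil)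

theorem eff_block (E : PKE) (C : Finset S.Party) (xs : S.Sanitized) (π : S.Perms)
    (y : S.Results) (z : S.User → List Bool) {k : Γ → ℕ} (hk : Det c fun γ => unary (k γ))
    {pkc : Γ → List Bool} (hpkc : Det c fun γ => ofStr (pkc γ)) (v : S.User) :
    Eff c fun γ => block E C xs π y z (k γ) (pkc γ) v := by
  unfold block
  split_ifs
  · exact eff_openBlock E hk hpkc _ _
  · exact eff_hiddenBlock E hk _

/-- Everything except `κ` is hard-wired into the program. -/
theorem eff_viewLaw (E : PKE) (C : Finset S.Party) (x : S.Inputs) (xs : S.Sanitized)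
    (π : S.Perms) (y : S.Results) (z : S.User → List Bool) :
    Eff unary fun κ => viewLaw E C x xs π y z κ := by
  refine eff_blockView E C x xs π Det.input fun v => ?_
  have i := Det.input (c := fun a : ℕ × List Bool => cons (unary a.1) (ofStr a.2))
  exact eff_block E C xs π y z (k := fun a : ℕ × List Bool => a.1)
    (pkc := fun a => (E.gen a.1 a.2).1) i.fst (E.det_gen i.fst i.snd).fst v

end Eff

/-! ## Replacing the results that the adversary does not know -/

/-- The test that runs `D` on a view together with the outputs `o`. -/
def accept (D : Prog) (κ : ℕ) (o w : Data) : PMF Bool :=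
  (output D (cons (unary κ) (cons w o))).map toBit

/-- The law of a hidden block does not involve the server's key, so it can be drawn before that key.
-/
theorem viewLaw_eq_hiddenBlock_bind (E : PKE) (C : Finset S.Party) (x : S.Inputs)
    (xs : S.Sanitized) (π : S.Perms) (y : S.Results) (z : S.User → List Bool) (κ : ℕ) {v : S.User}
    (hv : ¬ Visible C π v) :
    viewLaw E C x xs π y z κ = (hiddenBlock E κ (z v)).bind fun a =>
      blockView E C x xs π κ fun rc =>
        Function.update (block E C xs π y z κ (E.gen κ rc).1) v (PMF.pure a) := by
  unfold viewLaw blockView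
  rw [PMF.bind_comm]
  refine congrArg _ (funext fun rc => ?_)
  have h : block E C xs π y z κ (E.gen κ rc).1 v = hiddenBlock E κ (z v) := if_neg hv
  rw [seqD_eq_bind_update nodup_users _ v, PMF.map_bind]
  simp only [h]

/-- The reduction places the challenge key and ciphertext at position `v`, samples the server's key
and all other blocks itself, and runs `D` with the constant outputs `o`. It needs neither the secret
key nor any tape of position `v`. If `v` is visible, `z v` is not used at all. -/
theorem negligible_replace_one {E : PKE} (hE : E.INDCPA) (C : Finset S.Party) (x : S.Inputs)
    (xs : S.Sanitized) (π : S.Perms) (y : S.Results) (z : S.User → List Bool) (v : S.User)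
    {m : List Bool} (hm : (z v).length = m.length) {D : Prog} (hD : PPT D) (o : Data) :
    Negligible fun κ => |prTrue ((viewLaw E C x xs π y (Function.update z v m) κ).bind
      (accept D κ o)) - prTrue ((viewLaw E C x xs π y z κ).bind (accept D κ o))| := by
  by_cases hv : Visible C π v
  · have : ∀ κ, viewLaw E C x xs π y (Function.update z v m) κ = viewLaw E C x xs π y z κ := by
      intro κ
      unfold viewLaw
      congr 1
      funext rc u
      unfold block
      split_ifs with hu
      · rfl
      · rw [Function.update_of_ne (by rintro rfl; exact hu hv)]
    simpa [this] using Negligible.zero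
  let G : ℕ × List Bool × List Bool → PMF Data := fun a =>
    (blockView E C x xs π a.1 fun rc => Function.update
      (block E C xs π y z a.1 (E.gen a.1 rc).1) v (PMF.pure (hiddenData a.2.1 a.2.2))).bind
        fun w => output D (cons (unary a.1) (cons w o))
  have hG : Eff (fun a => cons (cons (unary a.1) (ofStr a.2.1)) (ofStr a.2.2)) G := by
    have i := Det.input
      (c := fun a : ℕ × List Bool × List Bool => cons (cons (unary a.1) (ofStr a.2.1)) (ofStr a.2.2))
    refine Eff.bind (d := fun d => d) ?_ ?_
    · simp only [map_id_fun]
      refine eff_blockView E C x xs π (k := fun a : ℕ × List Bool × List Bool => a.1) i.fst.fst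
        fun u => ?_
      have i := Det.input (c := fun b : (ℕ × List Bool × List Bool) × List Bool =>
        cons (cons (cons (unary b.1.1) (ofStr b.1.2.1)) (ofStr b.1.2.2)) (ofStr b.2))
      by_cases hu : u = v
      · subst hu
        simp only [Function.update_self]
        exact (i.fst.fst.snd.cons i.fst.snd).cons (Det.const nil)
      · simp only [Function.update_of_ne hu]
        exact eff_block E C xs π y z (k := fun b : (ℕ × List Bool × List Bool) × List Bool => b.1.1)
          (pkc := fun b => (E.gen b.1.1 b.2).1) i.fst.fst.fst
          (E.det_gen i.fst.fst.fst i.snd).fst u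
    · have i := Det.input (c := fun b : (ℕ × List Bool × List Bool) × Data =>
        cons (cons (cons (unary b.1.1) (ofStr b.1.2.1)) (ofStr b.1.2.2)) b.2)
      exact (Eff.of_prog hD).comp (fun b : (ℕ × List Bool × List Bool) × Data =>
        cons (unary b.1.1) (cons b.2 o)) (i.fst.fst.fst.cons (i.snd.cons (Det.const o)))
  have hgame : ∀ (z' : S.User → List Bool) (κ : ℕ), (∀ u, u ≠ v → z' u = z u) →
      (viewLaw E C x xs π y z' κ).bind (accept D κ o) = E.encGame G (z' v) κ := by
    intro z' κ hz'
    rw [viewLaw_eq_hiddenBlock_bind E C x xs π y z' κ hv]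
    unfold hiddenBlock PKE.encGame
    simp only [PMF.bind_bind, PMF.pure_bind]
    refine congrArg _ (funext fun r => congrArg _ (funext fun es => ?_))
    simp only [G, PMF.map_bind]
    have : ∀ rc, Function.update (block E C xs π y z' κ (E.gen κ rc).1) v (PMF.pure
        (hiddenData (E.gen κ r).1 (E.enc (E.gen κ r).1 (z' v) es))) =
        Function.update (block E C xs π y z κ (E.gen κ rc).1) v (PMF.pure
          (hiddenData (E.gen κ r).1 (E.enc (E.gen κ r).1 (z' v) es))) := by
      intro rc
      funext u
      by_cases hu : u = v
      · subst hu; simp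
      · rw [Function.update_of_ne hu, Function.update_of_ne hu, block, block, hz' u hu]
    simp only [this]
    rfl
  have := hE.encGame hG hm
  simpa only [hgame z _ fun _ _ => rfl, hgame (Function.update z v m) _ fun u hu =>
    Function.update_of_ne hu _ _, Function.update_self] using this

/-- The plaintexts that the simulator uses for unknown results. -/
def dummy (u : S.User) : List Bool := List.replicate (S.outLen u.1) false

/-- Hybrid argument over the positions; each result and its dummy have the same length. -/
theorem exists_negligible_replace {E : PKE} (hE : E.INDCPA) (C : Finset S.Party) (x : S.Inputs)
    (xs : S.Sanitized) (π : S.Perms) (y : S.Results) {D : Prog} (hD : PPT D) (o : Data) :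
    ∃ μ, Negligible μ ∧ ∀ κ, |prTrue ((viewLaw E C x xs π y (fun v => str (y v)) κ).bind
      (accept D κ o)) - prTrue ((viewLaw E C x xs π y dummy κ).bind (accept D κ o))| ≤ μ κ := by
  have key : ∀ s : Finset S.User, ∃ μ, Negligible μ ∧ ∀ κ,
      |prTrue ((viewLaw E C x xs π y (fun v => str (y v)) κ).bind (accept D κ o)) -
        prTrue ((viewLaw E C x xs π y (fun v => if v ∈ s then dummy v else str (y v)) κ).bind
          (accept D κ o))| ≤ μ κ := by
    intro s
    induction s using Finset.induction_on with
    | empty => exact ⟨_, Negligible.zero, fun κ => by simp⟩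
    | insert a s ha ih =>
      obtain ⟨μ, hμ, h⟩ := ih
      have h1 := negligible_replace_one hE C x xs π y
        (fun v => if v ∈ s then dummy v else str (y v)) a (m := dummy a)
        (by simp [ha, dummy, str]) hD o
      have h2 : Function.update (fun v => if v ∈ s then dummy v else str (y v)) a (dummy a) =
          fun v => if v ∈ insert a s then dummy v else str (y v) := by
        funext v
        by_cases hv : v = a
        · subst hv; simp
        · simp [hv]
      rw [h2] at h1
      refine ⟨_, hμ.add h1, fun κ => (abs_sub_le _ _ _).trans (add_le_add (h κ) ?_)⟩
      rw [abs_sub_comm]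
  simpa using key Finset.univ

/-! ## The simulator -/

theorem ofList_injective : Function.Injective ofList := by
  intro l
  induction l with
  | nil => intro l' h; cases l' <;> simp_all [ofList]
  | cons a l ih =>
    intro l' h
    cases l' with
    | nil => simp [ofList] at h
    | cons b l' =>
      simp only [ofList, Data.cons.injEq] at h
      rw [h.1, ih h.2]

theorem code_injective : Function.Injective (code (S := S)) := by
  intro g g' h
  have h1 := List.ofFn_injective (ofList_injective h)
  funext u
  exact congrFun (List.ofFn_injective (ofList_injective (congrFun h1 u.1))) u.2

theorem codeOn_eq {C : Finset S.Party} {g g' : S.User → Data} (h : codeOn C g = codeOn C g')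
    {u : S.User} (hu : some u ∈ C) : g u = g' u := by
  have := congrFun (code_injective h) u
  simpa [hu] using this

/-- What the functionality hands out, for given sanitized inputs, permutations and results. -/
def picOut (C : Finset S.Party) (xs : S.Sanitized) (π : S.Perms) (y : S.Results) : PICOut S where
  shuffled := fun v => xs (owner π v)
  results := y
  result := fun u => y (position π u)
  ownSan := fun u => if some u ∈ C then some (xs u) else none
  leakage := leak C π

/-- The simulated view depends on the input of the simulator only. -/
theorem viewLaw_dummy_congr (E : PKE) (C : Finset S.Party) {x x' : S.Inputs}
    {xs xs' : S.Sanitized} {π π' : S.Perms} {y y' : S.Results}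
    (h : simInput C x (picOut C xs π y) = simInput C x' (picOut C xs' π' y')) (κ : ℕ) :
    viewLaw E C x xs π y dummy κ = viewLaw E C x' xs' π' y' dummy κ := by
  have h0 := ofList_injective h
  simp only [List.cons.injEq, and_true] at h0
  obtain ⟨hU, hleak, hS⟩ := h0
  have hU' : ∀ u, some u ∈ C → str (x u) = str (x' u) ∧ str (xs u) = str (xs' u) ∧
      str (y (position π u)) = str (y' (position π' u)) := by
    intro u hu
    have := ofList_injective (codeOn_eq hU hu)
    simp only [picOut, hu, if_true, ofOption, List.cons.injEq, Data.cons.injEq, and_true,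
      ofStr_injective.eq_iff] at this
    exact this
  have hS' : none ∈ C → (∀ v, str (xs (owner π v)) = str (xs' (owner π' v))) ∧
      ∀ v, str (y v) = str (y' v) := by
    intro hC
    simp only [ifServer, hC, if_true] at hS
    have := ofList_injective hS
    simp only [List.cons.injEq, and_true] at this
    exact ⟨fun v => ofStr_injective (congrFun (code_injective this.1) v),
      fun v => ofStr_injective (congrFun (code_injective this.2) v)⟩
  have hpos : ∀ u, some u ∈ C → position π u = position π' u := by
    intro u hu
    have := congrFun (code_injective hleak) u
    simp only [picOut, leak, hu, if_true, ofOption, Data.cons.injEq, and_true] at this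
    have := congrArg Data.len this
    rw [len_unary, len_unary] at this
    exact Sigma.ext rfl (heq_of_eq (Fin.ext this))
  -- Equal leakage means that corrupted users sit at the same positions under both permutations.
  -- With `hown'` this makes visibility of a position agree on both sides.
  have hown : ∀ v, some (owner π v) ∈ C → owner π' v = owner π v := by
    intro v hv
    have := hpos _ hv
    rw [position_owner] at this
    rw [this, owner_position, ← this]
  have hown' : ∀ v, some (owner π' v) ∈ C → owner π v = owner π' v := by
    intro v hv
    have := hpos _ hv
    rw [position_owner] at this
    rw [← this, owner_position, this]
  unfold viewLaw blockView
  refine congrArg _ (funext fun rc => ?_)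
  have hasm : assemble E C x xs π κ rc = assemble E C x' xs' π' κ rc := by
    funext d
    unfold assemble
    rw [codeOn_congr fun u hu => ?_, show codeLeak (leak C π) = codeLeak (leak C π') from hleak]
    rw [(hU' u hu).1, (hU' u hu).2.1, hpos u hu]
  have hblock : block E C xs π y dummy κ (E.gen κ rc).1 =
      block E C xs' π' y' dummy κ (E.gen κ rc).1 := by
    funext v
    unfold block
    by_cases hC : none ∈ C
    · rw [if_pos (Or.inl hC), if_pos (Or.inl hC), (hS' hC).1 v, (hS' hC).2 v]
    · by_cases hv : some (owner π v) ∈ C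
      · have h1 := hU' _ hv
        have h2 : str (xs' (owner π v)) = str (xs' (owner π' v)) := by rw [hown v hv]
        have h3 : str (y v) = str (y' v) := by
          have := h1.2.2
          rwa [← hpos _ hv, position_owner] at this
        rw [if_pos (Or.inr hv), if_pos (Or.inr (by rwa [hown v hv])), h1.2.1, h2, h3]
      · rw [if_neg (by simp [hC, hv]), if_neg]
        rintro (h | h)
        · exact hC h
        · exact hv (by rwa [hown' v h])
  simp only [hasm, hblock]

/-- The simulator looks up some choice of the data that explains its input and samples the
corresponding view with dummy results. By `viewLaw_dummy_congr` it does not matter which choice is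
found. Results `y` are table entries, so one simulator serves all `f`. -/
theorem exists_simulator (E : PKE) (C : Finset S.Party) : ∃ Sim, PPT Sim ∧
    ∀ (κ : ℕ) (x : S.Inputs) (xs : S.Sanitized) (π : S.Perms) (y : S.Results),
      output Sim (cons (unary κ) (simInput C x (picOut C xs π y))) =
        viewLaw E C x xs π y dummy κ := by
  obtain ⟨p, hp, h⟩ := Eff.table (c := unary)
    (T := S.Inputs × S.Sanitized × S.Perms × S.Results)
    (w := fun t => simInput C t.1 (picOut C t.2.1 t.2.2.1 t.2.2.2))
    (F := fun t κ => viewLaw E C t.1 t.2.1 t.2.2.1 t.2.2.2 dummy κ)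
    (fun t => eff_viewLaw E C _ _ _ _ _)
    (fun t t' ht => funext fun κ => viewLaw_dummy_congr E C ht κ)
  exact ⟨p, hp, fun κ x xs π y => h (κ, x, xs, π, y)⟩

/-! ### Combining the two moves -/

/-- Security for fixed inputs, sanitized inputs and permutations. -/
theorem exists_negligible_fixed {E : PKE} (hE : E.INDCPA) (C : Finset S.Party) (x : S.Inputs)
    (xs : S.Sanitized) (π : S.Perms) (y : S.Results) {D : Prog} (hD : PPT D) :
    ∃ μ, Negligible μ ∧ ∀ κ, |prTrue (((indep fun _ : S.User => E.genTape κ).bind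
        (fixedExec E C x κ xs π y (retrieved E κ π y))).bind fun w =>
          (output D (cons (unary κ) w)).map toBit) -
      prTrue (((viewLaw E C x xs π y dummy κ).map fun w => cons w (codeOutputs
        (fun u => some (str (y (position π u)))) (fun v => xs (owner π v)) y)).bind fun w =>
          (output D (cons (unary κ) w)).map toBit)| ≤ μ κ := by
  obtain ⟨μ, hμ, h⟩ := exists_negligible_replace hE C x xs π y hD (codeOutputs
    (fun u => some (str (y (position π u)))) (fun v => xs (owner π v)) y)
  refine ⟨_, (Negligible.sum (Finset.univ : Finset S.User).offDiag
    (fun _ _ => hE.collision)).add hμ, fun κ => ?_⟩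
  -- The intermediate world has the real view and the ideal outputs.
  refine (abs_sub_le _ _ _).trans (add_le_add (abs_retrieved_sub_le E C x κ xs π y _) ?_)
  rw [bind_fixedExec, PMF.bind_map, PMF.bind_map]
  exact h κ

theorem securelyComputesPIC {E : PKE} (hE : E.INDCPA) (S : Setup) : SecurelyComputesPIC E S := by
  intro C
  obtain ⟨Sim, hSim, hSim'⟩ := exists_simulator (S := S) E C
  refine ⟨Sim, hSim, fun f D hD => ?_⟩
  choose μ hμ h using fun (x : S.Inputs) (xs : S.Sanitized) (π : S.Perms) =>
    exists_negligible_fixed hE C x xs π (f fun v => xs (owner π v)) hD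
  -- Summing over all inputs as well makes the bound independent of `x`; a single summand of that
  -- outer sum is used afterwards.
  refine ⟨fun κ => ∑ x, ∑ xs, ∑ π, μ x xs π κ, Negligible.sum _ fun x _ =>
    Negligible.sum _ fun xs _ => Negligible.sum _ fun π _ => hμ x xs π, fun κ x => ?_⟩
  have hideal : idealExec C f x Sim κ = (indep fun u : S.User => S.R u.1 (x u)).bind fun xs =>
      (PMF.uniformOfFintype S.Perms).bind fun π =>
        (viewLaw E C x xs π (f fun v => xs (owner π v)) dummy κ).map fun w =>
          cons w (codeOutputs
            (fun u => some (str (f (fun v => xs (owner π v)) (position π u))))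
            (fun v => xs (owner π v)) (f fun v => xs (owner π v))) := by
    simp only [idealExec, FPIC, bind, pure, PMF.bind_bind, PMF.pure_bind, ← hSim']
    rfl
  have hnonneg : ∀ x xs π, 0 ≤ μ x xs π κ := fun x xs π => (abs_nonneg _).trans (h x xs π κ)
  rw [realExec_eq, hideal]
  refine le_trans ?_ (Finset.single_le_sum (f := fun x => ∑ xs, ∑ π, μ x xs π κ)
    (fun x _ => Finset.sum_nonneg fun xs _ => Finset.sum_nonneg fun π _ => hnonneg x xs π)
    (Finset.mem_univ x))
  change |prTrue _ - prTrue _| ≤ _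
  rw [PMF.bind_bind, PMF.bind_bind]
  refine (abs_prTrue_bind_sub_le_sum _ _ _).trans (Finset.sum_le_sum fun xs _ => ?_)
  rw [PMF.bind_bind, PMF.bind_bind]
  refine (abs_prTrue_bind_sub_le_sum _ _ _).trans (Finset.sum_le_sum fun π _ => ?_)
  exact h x xs π κ

end Setup

end PIC

end

theorem mainTheorem4 (E : PIC.PKE) (hE : E.INDCPA) (S : PIC.Setup) :
    PIC.SecurelyComputesPIC E S :=
  PIC.Setup.securelyComputesPIC hE S
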